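/- Let $K$ be a field (for instance $K=\mathbb{R}$), let $n\ge 2$ and $m=2n$. Let $X_{m-1}\subset\mathbb{P}^{m-1}_K$ be the hypersurface $e_{m-1}(x_1,\dots,x_m)=0$, where $e_{m-1}$ is the elementary symmetric polynomial of degree $m-1$. Let $F=F_{n-1}(X_{m-1})\subset G(n,m)$ be the Fano scheme over $K$ of projective $(n-1)$-dimensional linear subspaces of $\mathbb{P}^{m-1}$ contained in $X_{m-1}$; here $G(r,N)$ denotes the Grassmannian of $r$-dimensional linear subspaces of an $N$-dimensional vector space. Then: (1) For every perfect matching $M$ of $\{1,\dots,m\}$, that is, every partition of this set into $n$ pairs, the linear space $$\{\,x_a+x_b=0 \text{ for all } \{a,b\}\in M\,\}$$ corresponds to exactly one point of $F$; this point is closed, and it is isolated (the one-point set is open in $F$). These points are pairwise distinct for different matchings, so that there are exactly $(m-1)!!=\dfrac{m!}{2^n\,n!}$ of them. (2) For $1\le i<j\le m$, let $Z_{ij}\subset F$ be the set of all points of $F$ (closed or not) whose corresponding linear space is contained in the coordinate subspace $\{x_i=x_j=0\}\cong\mathbb{P}^{m-3}$. Then $Z_{ij}$ is an irreducible component of $F$,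 and, with its reduced induced scheme structure, it is isomorphic over $K$ to the Grassmannian $G(n,m-2)$. The sets $Z_{ij}$ are pairwise distinct, so that there are exactly $\binom{m}{2}$ of them. -/

import Mathlib

open AlgebraicGeometry CategoryTheory

universe u

noncomputable section

namespace FanoPlanes

/-! ### Matrices, their column spaces, and maximal minors

An `m × r` matrix `U` whose columns are linearly independent represents the `r`-dimensional space
spanned by its columns, that is, a projective `(r - 1)`-plane in `ℙ^(m-1)`. -/

/-- The polynomial `f(U t)` in the parameters `t = (t_1, …, t_r)`: the restriction of `f` to the
column space of `U`.  The column space lies in the hypersurface `f = 0` if and only if this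
polynomial is zero. -/
def restrictTo {K S : Type u} [CommRing K] [CommRing S] [Algebra K S] {m r : ℕ}
    (U : Matrix (Fin m) (Fin r) S) (f : MvPolynomial (Fin m) K) : MvPolynomial (Fin r) S :=
  MvPolynomial.aeval
    (fun i => ∑ j, MvPolynomial.C (U i j) * MvPolynomial.X j : Fin m → MvPolynomial (Fin r) S) f

lemma map_restrictTo {K S R : Type u} [CommRing K] [CommRing S] [Algebra K S] [CommRing R]
    [Algebra K R] {m r : ℕ} (φ : S →ₐ[K] R) (U : Matrix (Fin m) (Fin r) S)
    (f : MvPolynomial (Fin m) K) :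
    MvPolynomial.map (φ : S →+* R) (restrictTo U f) = restrictTo (U.map φ) f := by
  have : (MvPolynomial.mapAlgHom (σ := Fin r) φ).comp (MvPolynomial.aeval
      (fun i => ∑ j, MvPolynomial.C (U i j) * MvPolynomial.X j : Fin m → MvPolynomial (Fin r) S)) =
      MvPolynomial.aeval (fun i => ∑ j, MvPolynomial.C ((U.map φ) i j) * MvPolynomial.X j :
        Fin m → MvPolynomial (Fin r) R) := by
    ext i
    simp
  exact DFunLike.congr_fun this f

/-- The `K`-algebra generated by the maximal minors of `U`, where every minor is multiplied by a
formal variable `T` that records the degree.  Rows are selected by arbitrary functions `σ`: a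
non-injective `σ` contributes zero and a reordering of the rows only changes the sign. -/
def pluckerAlgebra (K : Type u) {S : Type u} [CommRing K] [CommRing S] [Algebra K S] {m r : ℕ}
    (U : Matrix (Fin m) (Fin r) S) : Subalgebra K (Polynomial S) :=
  Algebra.adjoin K
    (Set.range fun σ : Fin r → Fin m => Polynomial.monomial 1 (U.submatrix σ id).det)

/-- The grading of the Plücker algebra by the degree in `T`: the maximal minors have degree one. -/
def pluckerGrading (K : Type u) {S : Type u} [CommRing K] [CommRing S] [Algebra K S] {m r : ℕ}
    (U : Matrix (Fin m) (Fin r) S) (d : ℕ) : Submodule K (pluckerAlgebra K U) where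
  carrier := {b | ∃ a : S, (b : Polynomial S) = Polynomial.monomial d a}
  add_mem' := by
    rintro _ _ ⟨a, ha⟩ ⟨b, hb⟩
    exact ⟨a + b, by simp [ha, hb]⟩
  zero_mem' := ⟨0, by simp⟩
  smul_mem' := by
    rintro c _ ⟨a, ha⟩
    refine ⟨c • a, ?_⟩
    rw [Subalgebra.coe_smul, ha, Polynomial.smul_monomial]

lemma monomial_coeff_mem {K S : Type u} [CommRing K] [CommRing S] [Algebra K S] {m r : ℕ}
    (U : Matrix (Fin m) (Fin r) S) {b : Polynomial S} (hb : b ∈ pluckerAlgebra K U) (d : ℕ) :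
    Polynomial.monomial d (b.coeff d) ∈ pluckerAlgebra K U := by
  induction hb using Algebra.adjoin_induction generalizing d with
  | mem x hx =>
    obtain ⟨σ, rfl⟩ := hx
    by_cases h : d = 1
    · subst h
      rw [Polynomial.coeff_monomial_same]
      exact Algebra.subset_adjoin ⟨σ, rfl⟩
    · have : (1 : ℕ) ≠ d := fun h' => h h'.symm
      simp [Polynomial.coeff_monomial, this]
  | algebraMap c =>
    rw [Polynomial.algebraMap_apply, Polynomial.coeff_C]
    split_ifs with h
    · subst h
      rw [Polynomial.monomial_zero_left, ← Polynomial.algebraMap_apply]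
      exact Subalgebra.algebraMap_mem _ c
    · simp
  | add x y _ _ hx hy =>
    rw [Polynomial.coeff_add, map_add]
    exact add_mem (hx d) (hy d)
  | mul x y _ _ hx hy =>
    rw [Polynomial.coeff_mul, map_sum]
    refine sum_mem fun p hp => ?_
    rw [← Finset.HasAntidiagonal.mem_antidiagonal.mp hp, ← Polynomial.monomial_mul_monomial]
    exact mul_mem (hx _) (hy _)

instance pluckerGradedMonoid (K : Type u) {S : Type u} [CommRing K] [CommRing S] [Algebra K S]
    {m r : ℕ} (U : Matrix (Fin m) (Fin r) S) : SetLike.GradedMonoid (pluckerGrading K U) where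
  one_mem := ⟨1, by simp⟩
  mul_mem := by
    rintro i j _ _ ⟨a, ha⟩ ⟨b, hb⟩
    exact ⟨a * b, by simp [ha, hb, Polynomial.monomial_mul_monomial]⟩

lemma coeff_coe {K S : Type u} [CommRing K] [CommRing S] [Algebra K S] {m r : ℕ}
    (U : Matrix (Fin m) (Fin r) S) (x : DirectSum ℕ fun d => pluckerGrading K U d) (d : ℕ) :
    Polynomial.monomial d
      (((DirectSum.coeAddMonoidHom (pluckerGrading K U) x : pluckerAlgebra K U) :
        Polynomial S).coeff d) = ((x d : pluckerAlgebra K U) : Polynomial S) := by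
  classical
  induction x using DirectSum.induction_on with
  | zero => simp
  | of i y =>
    obtain ⟨y, a, ha⟩ := y
    by_cases h : i = d
    · subst h
      simp [ha]
    · simp [ha, Polynomial.coeff_monomial, h, DirectSum.of_eq_of_ne _ _ _ (Ne.symm h)]
  | add x y hx hy => simp [hx, hy]

instance pluckerGradedAlgebra (K : Type u) {S : Type u} [CommRing K] [CommRing S] [Algebra K S]
    {m r : ℕ} (U : Matrix (Fin m) (Fin r) S) : GradedAlgebra (pluckerGrading K U) where
  decompose' b := DirectSum.mk (fun d => pluckerGrading K U d) (b : Polynomial S).support fun d =>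
    ⟨⟨Polynomial.monomial d ((b : Polynomial S).coeff d), monomial_coeff_mem U b.2 d⟩, _, rfl⟩
  left_inv b := by
    classical
    apply Subtype.ext
    ext d
    have h := coeff_coe U (DirectSum.mk (fun d => pluckerGrading K U d) (b : Polynomial S).support
      fun d => ⟨⟨Polynomial.monomial d ((b : Polynomial S).coeff d),
        monomial_coeff_mem U b.2 d⟩, _, rfl⟩) d
    have h' := congrArg (fun p : Polynomial S => p.coeff d) h
    simp only [Polynomial.coeff_monomial_same] at h'
    rw [h']
    by_cases hd : d ∈ (b : Polynomial S).support
    · rw [DirectSum.mk_apply_of_mem hd]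
      simp
    · rw [DirectSum.mk_apply_of_notMem hd]
      simpa using (Polynomial.notMem_support_iff.mp hd).symm
  right_inv x := by
    classical
    refine DFinsupp.ext fun d => Subtype.ext (Subtype.ext ?_)
    by_cases hd : d ∈ ((DirectSum.coeAddMonoidHom (pluckerGrading K U) x : pluckerAlgebra K U) :
        Polynomial S).support
    · refine (congrArg (fun z : pluckerGrading K U d => ((z : pluckerAlgebra K U) : Polynomial S))
        (DirectSum.mk_apply_of_mem (β := fun d => pluckerGrading K U d) hd)).trans ?_
      exact coeff_coe U x d
    · refine (congrArg (fun z : pluckerGrading K U d => ((z : pluckerAlgebra K U) : Polynomial S))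
        (DirectSum.mk_apply_of_notMem (β := fun d => pluckerGrading K U d) hd)).trans ?_
      rw [← coeff_coe U x d, Polynomial.notMem_support_iff.mp hd]
      simp

/-- `Proj` of the Plücker algebra of `U`. -/
abbrev pluckerProj (K : Type u) {S : Type u} [CommRing K] [CommRing S] [Algebra K S] {m r : ℕ}
    (U : Matrix (Fin m) (Fin r) S) : Scheme.{u} :=
  Proj (pluckerGrading K U)

/-- The structure morphism of `pluckerProj K U` over `Spec K`. -/
def pluckerProjToSpec (K : Type u) {S : Type u} [CommRing K] [CommRing S] [Algebra K S] {m r : ℕ}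
    (U : Matrix (Fin m) (Fin r) S) : pluckerProj K U ⟶ Spec (.of K) :=
  Proj.toSpecZero (pluckerGrading K U) ≫
    Spec.map (CommRingCat.ofHom (algebraMap K (pluckerGrading K U 0)))

/-! ### Grassmannian and Fano scheme -/

/-- The Grassmannian `G(r, m)` of `r`-dimensional subspaces of an `m`-dimensional vector space over
`K` in its Plücker embedding: `Proj` of the algebra generated by the maximal minors of the generic
`m × r` matrix.  It is regarded as a scheme over `Spec K`. -/
def grassmannian (K : Type u) [Field K] (r m : ℕ) : Over (Spec (.of K)) :=
  Over.mk (pluckerProjToSpec K (Matrix.mvPolynomialX (Fin m) (Fin r) K))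

/-- The ideal, in the coordinate ring of `m × r` matrices `U`, of the condition that the column
space of `U` lies in `f = 0`: it is generated by the coefficients of `f(U t)` with respect
to `t`. -/
def fanoIdeal {K : Type u} [Field K] {m : ℕ} (r : ℕ) (f : MvPolynomial (Fin m) K) :
    Ideal (MvPolynomial (Fin m × Fin r) K) :=
  Ideal.span (Set.range fun d : Fin r →₀ ℕ =>
    (restrictTo (Matrix.mvPolynomialX (Fin m) (Fin r) K) f).coeff d)

/-- The coordinate ring of the `m × r` matrices whose column space lies in `f = 0`. -/
abbrev FanoRing {K : Type u} [Field K] {m : ℕ} (r : ℕ) (f : MvPolynomial (Fin m) K) : Type u :=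
  MvPolynomial (Fin m × Fin r) K ⧸ fanoIdeal r f

/-- The universal `m × r` matrix whose column space lies in `f = 0`. -/
def fanoMatrix {K : Type u} [Field K] {m : ℕ} (r : ℕ) (f : MvPolynomial (Fin m) K) :
    Matrix (Fin m) (Fin r) (FanoRing r f) :=
  (Matrix.mvPolynomialX (Fin m) (Fin r) K).map (Ideal.Quotient.mkₐ K (fanoIdeal r f))

/-- The Fano scheme `F_{r-1}(X)` of projective `(r - 1)`-planes in the hypersurface
`X = {f = 0} ⊂ ℙ^(m-1)`, as the closed subscheme of the Plücker embedded Grassmannian `G(r, m)`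
whose homogeneous ideal consists of the polynomials in the maximal minors that lie in `fanoIdeal`
(that is, vanish modulo the coefficients of `f(U t)`).  Equivalently, it is `Proj` of the image of
the Plücker algebra of the generic matrix in the polynomials over `FanoRing`, which is the algebra
generated by the maximal minors of the universal matrix `fanoMatrix`.  On the standard chart of the
Grassmannian on which the minor of the rows `σ` is invertible, normalised by making these rows the
identity matrix, it is cut out by the coefficients of `f(U t)`. -/
abbrev fanoScheme {K : Type u} [Field K] {m : ℕ} (r : ℕ) (f : MvPolynomial (Fin m) K) :
    Scheme.{u} :=
  pluckerProj K (fanoMatrix r f)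

/-- The structure morphism of the Fano scheme over `Spec K`. -/
def fanoSchemeToSpec {K : Type u} [Field K] {m : ℕ} (r : ℕ) (f : MvPolynomial (Fin m) K) :
    fanoScheme r f ⟶ Spec (.of K) :=
  pluckerProjToSpec K (fanoMatrix r f)

/-! ### The points of the Fano scheme given by linear subspaces -/

/-- Evaluation of the coordinate ring `FanoRing` at a matrix `U` over an extension of `K` whose
column space lies in `f = 0`. -/
def evalMatrix {K : Type u} [Field K] {m r : ℕ} {f : MvPolynomial (Fin m) K} {L : Type u} [Field L]
    [Algebra K L] (U : Matrix (Fin m) (Fin r) L) (hf : restrictTo U f = 0) :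
    FanoRing r f →ₐ[K] L :=
  Ideal.Quotient.liftₐ (fanoIdeal r f)
    (MvPolynomial.aeval fun p : Fin m × Fin r => U p.1 p.2) (by
      intro a ha
      have hle : fanoIdeal r f ≤ RingHom.ker
          (MvPolynomial.aeval (R := K) fun p : Fin m × Fin r => U p.1 p.2) := by
        refine Ideal.span_le.mpr ?_
        rintro _ ⟨d, rfl⟩
        have h := map_restrictTo (MvPolynomial.aeval (R := K) fun p : Fin m × Fin r => U p.1 p.2)
          (Matrix.mvPolynomialX (Fin m) (Fin r) K) f
        have hU : (Matrix.mvPolynomialX (Fin m) (Fin r) K).map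
            (MvPolynomial.aeval (R := K) fun p : Fin m × Fin r => U p.1 p.2) = U := by
          ext i j
          simp
        rw [hU, hf] at h
        have h' := congrArg (MvPolynomial.coeff d) h
        rw [MvPolynomial.coeff_map, MvPolynomial.coeff_zero] at h'
        exact h'
      exact hle ha)

lemma fanoMatrix_map_evalMatrix {K : Type u} [Field K] {m r : ℕ} {f : MvPolynomial (Fin m) K}
    {L : Type u} [Field L] [Algebra K L] (U : Matrix (Fin m) (Fin r) L)
    (hf : restrictTo U f = 0) : (fanoMatrix r f).map (evalMatrix U hf) = U := by
  ext i j
  change MvPolynomial.aeval (R := K) (fun p : Fin m × Fin r => U p.1 p.2)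
    (Matrix.mvPolynomialX (Fin m) (Fin r) K i j) = U i j
  simp

lemma exists_minor_ne_zero {L : Type u} [Field L] {m r : ℕ} (U : Matrix (Fin m) (Fin r) L)
    (hU : LinearIndependent L U.col) : ∃ σ : Fin r → Fin m, (U.submatrix σ id).det ≠ 0 := by
  have hrank : U.rank = r := by
    rw [Matrix.rank_eq_finrank_span_cols, finrank_span_eq_card hU, Fintype.card_fin]
  obtain ⟨κ, a, ha, hspan, hli⟩ := exists_linearIndependent' L U.row
  have : Finite κ := Finite.of_injective a ha
  have : Fintype κ := Fintype.ofFinite κ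
  have hcard : Fintype.card κ = r := by
    rw [← finrank_span_eq_card hli, hspan, ← Matrix.rank_eq_finrank_span_row, hrank]
  let e : Fin r ≃ κ := (Fintype.equivFinOfCardEq hcard).symm
  refine ⟨a ∘ e, ?_⟩
  have h : LinearIndependent L (U.submatrix (a ∘ e) id).row := hli.comp e e.injective
  exact ((Matrix.isUnit_iff_isUnit_det _).mp
    (Matrix.linearIndependent_rows_iff_isUnit.mp h)).ne_zero

/-- The homogeneous coordinates of the point given by `U`: the graded homomorphism from the
homogeneous coordinate ring of the Fano scheme to `L[T]` that evaluates the minors at `U`. -/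
def evalPlucker {K : Type u} [Field K] {m r : ℕ} {f : MvPolynomial (Fin m) K} {L : Type u} [Field L]
    [Algebra K L] (U : Matrix (Fin m) (Fin r) L) (hf : restrictTo U f = 0) :
    pluckerAlgebra K (fanoMatrix r f) →ₐ[K] Polynomial L :=
  (Polynomial.mapAlgHom (evalMatrix U hf)).comp (pluckerAlgebra K (fanoMatrix r f)).val

lemma ker_evalPlucker_isHomogeneous {K : Type u} [Field K] {m r : ℕ} {f : MvPolynomial (Fin m) K}
    {L : Type u} [Field L] [Algebra K L] (U : Matrix (Fin m) (Fin r) L)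
    (hf : restrictTo U f = 0) : (RingHom.ker (evalPlucker U hf)).IsHomogeneous
      (pluckerGrading K (fanoMatrix r f)) := by
  intro d b hb
  have hc := coeff_coe (fanoMatrix r f)
    (DirectSum.decompose (pluckerGrading K (fanoMatrix r f)) b) d
  have hs : DirectSum.coeAddMonoidHom (pluckerGrading K (fanoMatrix r f))
      (DirectSum.decompose (pluckerGrading K (fanoMatrix r f)) b) = b :=
    (DirectSum.decompose (pluckerGrading K (fanoMatrix r f))).symm_apply_apply b
  rw [hs] at hc
  have hb' : Polynomial.map (evalMatrix U hf : FanoRing r f →+* L) (b : Polynomial _) = 0 := hb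
  change Polynomial.map (evalMatrix U hf : FanoRing r f →+* L)
    ((DirectSum.decompose (pluckerGrading K (fanoMatrix r f)) b d :
      pluckerAlgebra K (fanoMatrix r f)) : Polynomial _) = 0
  rw [← hc, Polynomial.map_monomial, ← Polynomial.coeff_map, hb']
  simp

lemma not_irrelevant_le_ker_evalPlucker {K : Type u} [Field K] {m r : ℕ}
    {f : MvPolynomial (Fin m) K} {L : Type u} [Field L] [Algebra K L]
    (U : Matrix (Fin m) (Fin r) L) (hU : LinearIndependent L U.col)
    (hf : restrictTo U f = 0) :
    ¬ (HomogeneousIdeal.irrelevant (pluckerGrading K (fanoMatrix r f)) ≤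
      ⟨RingHom.ker (evalPlucker U hf), ker_evalPlucker_isHomogeneous U hf⟩) := by
  intro hle
  obtain ⟨σ, hσ⟩ := exists_minor_ne_zero U hU
  let b : pluckerAlgebra K (fanoMatrix r f) :=
    ⟨Polynomial.monomial 1 ((fanoMatrix r f).submatrix σ id).det,
      Algebra.subset_adjoin ⟨σ, rfl⟩⟩
  have hb1 : b ∈ pluckerGrading K (fanoMatrix r f) 1 := ⟨_, rfl⟩
  have hb : b ∈ HomogeneousIdeal.irrelevant (pluckerGrading K (fanoMatrix r f)) :=
    DirectSum.decompose_of_mem_ne _ hb1 one_ne_zero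
  have h0 : evalPlucker U hf b = 0 := hle hb
  have h1 : evalPlucker U hf b = Polynomial.monomial 1 (U.submatrix σ id).det := by
    change Polynomial.map (evalMatrix U hf : FanoRing r f →+* L)
      (Polynomial.monomial 1 ((fanoMatrix r f).submatrix σ id).det) = _
    rw [Polynomial.map_monomial, RingHom.map_det, RingHom.mapMatrix_apply,
      ← Matrix.submatrix_map]
    exact congrArg (fun V : Matrix (Fin m) (Fin r) L =>
      Polynomial.monomial 1 (V.submatrix σ id).det) (fanoMatrix_map_evalMatrix U hf)
  rw [h1] at h0
  exact hσ ((Polynomial.monomial_eq_zero_iff _ _).mp h0)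

/-- The point of the Fano scheme given by an `m × r` matrix `U` over an extension field `L` of `K`
which has linearly independent columns and whose column space lies in `f = 0`: the ideal of all
forms in the Plücker coordinates that vanish at `U`. -/
def matrixPoint {K : Type u} [Field K] {m r : ℕ} {f : MvPolynomial (Fin m) K} {L : Type u} [Field L]
    [Algebra K L] (U : Matrix (Fin m) (Fin r) L) (hU : LinearIndependent L U.col)
    (hf : restrictTo U f = 0) : fanoScheme r f :=
  (⟨⟨RingHom.ker (evalPlucker U hf), ker_evalPlucker_isHomogeneous U hf⟩,
    RingHom.ker_isPrime _, not_irrelevant_le_ker_evalPlucker U hU hf⟩ :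
    ProjectiveSpectrum (pluckerGrading K (fanoMatrix r f)))

/-- `x` is the point of the Fano scheme that corresponds to the linear subspace `W` of `L^m`, where
`L` is an extension field of `K`: it is given by a matrix whose columns are a basis of `W`. -/
def IsPointOf {K : Type u} [Field K] {m r : ℕ} {f : MvPolynomial (Fin m) K} (x : fanoScheme r f)
    {L : Type u} [Field L] [Algebra K L] (W : Submodule L (Fin m → L)) : Prop :=
  ∃ (U : Matrix (Fin m) (Fin r) L) (hU : LinearIndependent L U.col) (hf : restrictTo U f = 0),
    Submodule.span L (Set.range U.col) = W ∧ x = matrixPoint U hU hf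

/-- The closed subset `Z` of the `K`-scheme `X` with its reduced induced structure, as a scheme
over `Spec K`. -/
def reducedClosed {K : Type u} [Field K] {X : Scheme.{u}} (p : X ⟶ Spec (.of K))
    (Z : TopologicalSpace.Closeds X) : Over (Spec (.of K)) :=
  Over.mk ((Scheme.IdealSheafData.vanishingIdeal Z).subschemeι ≫ p)

/-! ### The elementary symmetric hypersurface -/

/-- The Fano scheme `F_{n-1}(X_{m-1})`, `m = 2n`, of projective `(n - 1)`-planes in the elementary
symmetric hypersurface `X_{m-1} = {e_{m-1} = 0} ⊂ ℙ^(m-1)` over `K`. -/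
abbrev esymmFano (K : Type u) [Field K] (n : ℕ) : Scheme.{u} :=
  fanoScheme n (MvPolynomial.esymm (Fin (2 * n)) K (2 * n - 1))

/-- The subspace of `K^m` cut out by the equations `x_a + x_b = 0`, one for every edge `{a, b}`
of `M`. -/
def matchingSpace (K : Type u) [Field K] {m : ℕ} (M : (⊤ : SimpleGraph (Fin m)).Subgraph) :
    Submodule K (Fin m → K) where
  carrier := {v | ∀ a b, M.Adj a b → v a + v b = 0}
  add_mem' := by
    intro v w hv hw a b hab
    have h : (v + w) a + (v + w) b = (v a + v b) + (w a + w b) := by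
      simp only [Pi.add_apply]; ring
    rw [h, hv a b hab, hw a b hab, add_zero]
  zero_mem' := by intro a b _; simp
  smul_mem' := by
    intro c v hv a b hab
    have h : (c • v) a + (c • v) b = c * (v a + v b) := by
      simp only [Pi.smul_apply, smul_eq_mul]; ring
    rw [h, hv a b hab, mul_zero]

/-- The set of all points of the Fano scheme that correspond to linear subspaces of the
codimension-two coordinate subspace `x_i = x_j = 0` (over arbitrary extension fields `L` of `K`, so
that non-closed points are included). -/
def planesInCoordinateSubspace (K : Type u) [Field K] (n : ℕ) (i j : Fin (2 * n)) :
    Set (esymmFano K n) :=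
  {x | ∃ (L : Type u) (_ : Field L) (_ : Algebra K L) (W : Submodule L (Fin (2 * n) → L)),
    IsPointOf x W ∧ ∀ v ∈ W, v i = 0 ∧ v j = 0}

end FanoPlanes

end

noncomputable section

namespace FanoPlanes

/-! ### Matrices and minors -/

/-! Restricting `e_(m-1)` to the column space of a matrix `U` over a field `L` gives `∑ i, ∏ j ≠ i,
ℓ_j`, where `ℓ_j` is the linear form given by row `j`. Suppose this vanishes. If one form is zero,
only one summand can survive, so a second form is zero and the plane lies in some `x_i = x_j = 0`.
If no form is zero, each `ℓ_i` is prime in `L[t]` and divides some other `ℓ_j`, so every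
proportionality class of forms has at least two members. The rank of `U` is `n`, so there are at
least `n` classes; as there are only `2n` forms, all classes are pairs. Divisibility by `ℓ_i ^ 2`
then forces the ratio in each pair to be `-1`, and the plane is the space of a perfect matching
(`exists_involution_of_row_ne_zero`).

To turn this into a statement about all points of the scheme, `exists_matrixPoint` represents every
homogeneous prime by a matrix over a field, built from Plücker coordinates by Cramer's rule. Hence
`F` is the union of finitely many rational, thus closed, matching points and the finitely many sets
`Z_ij` (`isPointOf_matchingSpace_or_mem_planes`).

Inserting two zero rows into the generic matrix gives a surjection of graded rings from the
coordinate ring of `F` to that of `G(n, m-2)`. On `Proj` it is a closed immersion with reduced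
source and image `Z_ij`, which yields the isomorphism; its kernel is the generic point of `Z_ij`. No
matching point lies on any `Z_ij` and the `Z_ij` do not contain one another, so the matching points
are open and the `Z_ij` are components. The matchings are counted as permutations of cycle type
`2^n`. -/

lemma mul_adjugate_submatrix_apply {S : Type u} [CommRing S] {m r : ℕ}
    (U : Matrix (Fin m) (Fin r) S) (σ : Fin r → Fin m) (i : Fin m) (j : Fin r) :
    (U * (U.submatrix σ id).adjugate) i j = (U.submatrix (Function.update σ j i) id).det := by
  -- Cramer's rule: replacing row `j` of the square block `σ` by row `i` of `U` again gives a
  -- maximal minor of `U`. All reconstructions of a plane from its minors rest on this.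
  have h := Matrix.cramer_transpose_apply (U.submatrix σ id) (U.row i) j
  have e : (U.submatrix σ id).updateRow j (U.row i) = U.submatrix (Function.update σ j i) id := by
    ext a b
    by_cases hab : a = j
    · subst hab; simp [Matrix.row]
    · simp [Matrix.updateRow_ne hab, Function.update_of_ne hab]
  rw [e, Matrix.cramer_eq_adjugate_mulVec, ← Matrix.adjugate_transpose, Matrix.mulVec_transpose] at h
  exact h

lemma linearIndependent_col_of_minor_ne_zero {L : Type u} [Field L] {m r : ℕ}
    (U : Matrix (Fin m) (Fin r) L) {σ : Fin r → Fin m} (h : (U.submatrix σ id).det ≠ 0) :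
    LinearIndependent L U.col := by
  rw [← Matrix.mulVec_injective_iff]
  intro v w hvw
  have hu : IsUnit (U.submatrix σ id) := (Matrix.isUnit_iff_isUnit_det _).mpr h.isUnit
  apply Matrix.mulVec_injective_of_isUnit hu
  funext a
  exact congrFun hvw (σ a)

/-- Up to the nonzero factor `det U_σ`, `U` equals `(U * adj U_σ) * U_σ`, and row `i` of the first
factor consists of minors that involve row `i`. -/
lemma row_eq_zero_of_minors {L : Type u} [Field L] {m r : ℕ} (U : Matrix (Fin m) (Fin r) L)
    (hU : LinearIndependent L U.col) (i : Fin m)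
    (h : ∀ τ : Fin r → Fin m, i ∈ Set.range τ → (U.submatrix τ id).det = 0) : U i = 0 := by
  obtain ⟨σ, hσ⟩ := exists_minor_ne_zero U hU
  have h0 : (U * (U.submatrix σ id).adjugate) i = 0 := by
    funext j
    rw [mul_adjugate_submatrix_apply]
    exact h _ ⟨j, by simp⟩
  have h1 : (U * (U.submatrix σ id).adjugate * U.submatrix σ id) i = 0 := by
    rw [Matrix.mul_apply_eq_vecMul, h0, Matrix.zero_vecMul]
  rw [Matrix.mul_assoc, Matrix.adjugate_mul, Matrix.mul_smul, Matrix.mul_one] at h1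
  funext j
  have h2 : (U.submatrix σ id).det * U i j = 0 := congrFun h1 j
  exact (mul_eq_zero.mp h2).resolve_left hσ

/-- Two matrices with proportional maximal minors have the same column space. -/
lemma exists_eq_mul_of_minors {L : Type u} [Field L] {m r : ℕ} (U V : Matrix (Fin m) (Fin r) L)
    (hV : LinearIndependent L V.col) {c : L}
    (h : ∀ τ : Fin r → Fin m, (V.submatrix τ id).det = c * (U.submatrix τ id).det) :
    ∃ G : Matrix (Fin r) (Fin r) L, V = U * G := by
  obtain ⟨σ, hσ⟩ := exists_minor_ne_zero V hV
  have h0 : V * (V.submatrix σ id).adjugate = c • (U * (U.submatrix σ id).adjugate) := by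
    ext i j
    rw [Matrix.smul_apply, mul_adjugate_submatrix_apply, mul_adjugate_submatrix_apply, h,
      smul_eq_mul]
  have h1 := congrArg (· * V.submatrix σ id) h0
  simp only [Matrix.mul_assoc, Matrix.adjugate_mul, Matrix.mul_smul, Matrix.mul_one,
    Matrix.smul_mul] at h1
  refine ⟨((V.submatrix σ id).det)⁻¹ • c • ((U.submatrix σ id).adjugate * V.submatrix σ id), ?_⟩
  rw [Matrix.mul_smul, Matrix.mul_smul, ← h1, smul_smul, inv_mul_cancel₀ hσ, one_smul]

lemma submatrix_mul_det {S : Type u} [CommRing S] {m r : ℕ} (U : Matrix (Fin m) (Fin r) S)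
    (G : Matrix (Fin r) (Fin r) S) (τ : Fin r → Fin m) :
    ((U * G).submatrix τ id).det = (U.submatrix τ id).det * G.det := by
  rw [← Matrix.det_mul]
  rfl

lemma map_submatrix_det {S R F : Type u} [CommRing S] [CommRing R] [FunLike F S R]
    [RingHomClass F S R] (φ : F) {m r : ℕ} (U : Matrix (Fin m) (Fin r) S) (τ : Fin r → Fin m) :
    ((U.map φ).submatrix τ id).det = φ (U.submatrix τ id).det := by
  change _ = (φ : S →+* R) _
  rw [RingHom.map_det]
  rfl

/-- Right multiplication by `G` is the linear substitution `t ↦ G t` in the parameters, which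
preserves zero whether or not `G` is invertible. -/
lemma restrictTo_mul_eq_zero {K S : Type u} [CommRing K] [CommRing S] [Algebra K S] {m r : ℕ}
    {f : MvPolynomial (Fin m) K} (U : Matrix (Fin m) (Fin r) S) (G : Matrix (Fin r) (Fin r) S)
    (h : restrictTo U f = 0) : restrictTo (U * G) f = 0 := by
  have key : ((MvPolynomial.aeval (R := S) fun j => ∑ k, MvPolynomial.C (G j k) *
      MvPolynomial.X (R := S) k : MvPolynomial (Fin r) S →ₐ[S] MvPolynomial (Fin r) S).restrictScalars
        K).comp (MvPolynomial.aeval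
      (fun i => ∑ j, MvPolynomial.C (U i j) * MvPolynomial.X j : Fin m → MvPolynomial (Fin r) S)) =
      MvPolynomial.aeval (fun i => ∑ j, MvPolynomial.C ((U * G) i j) * MvPolynomial.X j :
        Fin m → MvPolynomial (Fin r) S) := by
    ext1 i
    simp only [AlgHom.comp_apply, MvPolynomial.aeval_X, AlgHom.restrictScalars_apply, map_sum,
      map_mul, MvPolynomial.aeval_C, Matrix.mul_apply, Finset.sum_mul, Finset.mul_sum,
      MvPolynomial.algebraMap_eq]
    rw [Finset.sum_comm]
    simp only [mul_assoc]
  refine (DFunLike.congr_fun key f).symm.trans ?_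
  exact (congrArg (MvPolynomial.aeval _) h).trans (map_zero _)

lemma restrictTo_fanoMatrix {K : Type u} [Field K] {m r : ℕ} (f : MvPolynomial (Fin m) K) :
    restrictTo (fanoMatrix r f) f = 0 := by
  rw [fanoMatrix, ← map_restrictTo]
  ext d
  rw [MvPolynomial.coeff_map, MvPolynomial.coeff_zero]
  exact Ideal.Quotient.eq_zero_iff_mem.mpr (Ideal.subset_span ⟨d, rfl⟩)

/-! ### The Plücker algebra -/

/-- The maximal minor with rows `σ`, as a degree one element of the Plücker algebra. -/
def pluckerCoord (K : Type u) {S : Type u} [CommRing K] [CommRing S] [Algebra K S] {m r : ℕ}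
    (U : Matrix (Fin m) (Fin r) S) (σ : Fin r → Fin m) : pluckerAlgebra K U :=
  ⟨Polynomial.monomial 1 (U.submatrix σ id).det, Algebra.subset_adjoin ⟨σ, rfl⟩⟩

lemma pluckerCoord_mem_one (K : Type u) {S : Type u} [CommRing K] [CommRing S] [Algebra K S]
    {m r : ℕ} (U : Matrix (Fin m) (Fin r) S) (σ : Fin r → Fin m) :
    pluckerCoord K U σ ∈ pluckerGrading K U 1 := ⟨_, rfl⟩

lemma pluckerAlgebra_induction {K S : Type u} [CommRing K] [CommRing S] [Algebra K S] {m r : ℕ}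
    {U : Matrix (Fin m) (Fin r) S} {p : pluckerAlgebra K U → Prop}
    (coord : ∀ σ, p (pluckerCoord K U σ)) (algebraMap : ∀ c : K, p (algebraMap K _ c))
    (add : ∀ x y, p x → p y → p (x + y)) (mul : ∀ x y, p x → p y → p (x * y))
    (b : pluckerAlgebra K U) : p b := by
  obtain ⟨b, hb⟩ := b
  induction hb using Algebra.adjoin_induction with
  | mem x hx => obtain ⟨σ, rfl⟩ := hx; exact coord σ
  | algebraMap c => exact algebraMap c
  | add x y hx hy h1 h2 => exact add _ _ h1 h2
  | mul x y hx hy h1 h2 => exact mul _ _ h1 h2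

lemma pluckerAlgebra_algHom_ext {K S B : Type u} [CommRing K] [CommRing S] [Algebra K S]
    [CommRing B] [Algebra K B] {m r : ℕ} {U : Matrix (Fin m) (Fin r) S}
    {φ ψ : pluckerAlgebra K U →ₐ[K] B}
    (h : ∀ σ, φ (pluckerCoord K U σ) = ψ (pluckerCoord K U σ)) : φ = ψ := by
  refine AlgHom.ext fun b => ?_
  induction b using pluckerAlgebra_induction with
  | coord σ => exact h σ
  | algebraMap c => simp
  | add x y hx hy => simp [hx, hy]
  | mul x y hx hy => simp [hx, hy]

lemma coe_decompose {K S : Type u} [CommRing K] [CommRing S] [Algebra K S] {m r : ℕ}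
    {U : Matrix (Fin m) (Fin r) S} (b : pluckerAlgebra K U) (d : ℕ) :
    ((DirectSum.decompose (pluckerGrading K U) b d : pluckerAlgebra K U) : Polynomial S) =
      Polynomial.monomial d ((b : Polynomial S).coeff d) := by
  have hc := coeff_coe U (DirectSum.decompose (pluckerGrading K U) b) d
  have hs : DirectSum.coeAddMonoidHom (pluckerGrading K U)
      (DirectSum.decompose (pluckerGrading K U) b) = b :=
    (DirectSum.decompose (pluckerGrading K U)).symm_apply_apply b
  rw [hs] at hc
  exact hc.symm

/-- Modulo the Plücker coordinates every element is a constant, namely its coefficient in degree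
zero. This ensures that at each point of `Proj` some coordinate does not vanish. -/
lemma irrelevant_le_span_pluckerCoord (K : Type u) {S : Type u} [CommRing K] [CommRing S]
    [Algebra K S] {m r : ℕ} (U : Matrix (Fin m) (Fin r) S) :
    (HomogeneousIdeal.irrelevant (pluckerGrading K U)).toIdeal ≤
      Ideal.span (Set.range (pluckerCoord K U)) := by
  have key : ∀ b : pluckerAlgebra K U, ∃ c : K,
      b - algebraMap K _ c ∈ Ideal.span (Set.range (pluckerCoord K U)) ∧
        (b : Polynomial S).coeff 0 = algebraMap K S c := by
    intro b
    induction b using pluckerAlgebra_induction with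
    | coord σ =>
      refine ⟨0, by rw [map_zero, sub_zero]; exact Ideal.subset_span ⟨σ, rfl⟩, ?_⟩
      simp [pluckerCoord, Polynomial.coeff_monomial]
    | algebraMap c =>
      refine ⟨c, by simp, ?_⟩
      change (algebraMap K (Polynomial S) c).coeff 0 = _
      simp [Polynomial.algebraMap_apply]
    | add x y hx hy =>
      obtain ⟨c, hc, hc'⟩ := hx
      obtain ⟨d, hd, hd'⟩ := hy
      refine ⟨c + d, ?_, by simp [hc', hd']⟩
      have := add_mem hc hd
      rw [map_add]
      convert! this using 1
      ring
    | mul x y hx hy =>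
      obtain ⟨c, hc, hc'⟩ := hx
      obtain ⟨d, hd, hd'⟩ := hy
      refine ⟨c * d, ?_, by simp [Polynomial.mul_coeff_zero, hc', hd']⟩
      have := add_mem (Ideal.mul_mem_left _ x hd) (Ideal.mul_mem_left _ (algebraMap K _ d) hc)
      rw [map_mul]
      convert! this using 1
      ring
  intro b hb
  obtain ⟨c, hc, hc'⟩ := key b
  have h0 : (DirectSum.decompose (pluckerGrading K U) b 0 : pluckerAlgebra K U) = 0 := hb
  have h1 := coe_decompose b 0
  rw [h0, hc'] at h1
  -- The constant `c` itself may be nonzero, since `K → S` need not be injective here; only its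
  -- image in the algebra matters.
  have h2 : algebraMap K (pluckerAlgebra K U) c = 0 := by
    apply Subtype.ext
    rw [h1, Polynomial.monomial_zero_left]
    rfl
  rwa [h2, sub_zero] at hc

/-! ### Points of the Fano scheme -/

section Points

variable {K : Type u} [Field K] {m r : ℕ} {f : MvPolynomial (Fin m) K}

lemma evalPlucker_pluckerCoord {L : Type u} [Field L] [Algebra K L] (U : Matrix (Fin m) (Fin r) L)
    (hf : restrictTo U f = 0) (σ : Fin r → Fin m) :
    evalPlucker U hf (pluckerCoord K (fanoMatrix r f) σ) =
      Polynomial.monomial 1 (U.submatrix σ id).det := by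
  change Polynomial.map (evalMatrix U hf : FanoRing r f →+* L)
    (Polynomial.monomial 1 ((fanoMatrix r f).submatrix σ id).det) = _
  rw [Polynomial.map_monomial]
  congr 1
  conv_rhs => rw [← fanoMatrix_map_evalMatrix U hf]
  exact (map_submatrix_det _ _ _).symm

lemma mem_matrixPoint {L : Type u} [Field L] [Algebra K L] {U : Matrix (Fin m) (Fin r) L}
    {hU : LinearIndependent L U.col} {hf : restrictTo U f = 0}
    {b : pluckerAlgebra K (fanoMatrix r f)} :
    b ∈ (matrixPoint U hU hf).asHomogeneousIdeal ↔ evalPlucker U hf b = 0 := Iff.rfl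

lemma pluckerCoord_mem_matrixPoint {L : Type u} [Field L] [Algebra K L]
    {U : Matrix (Fin m) (Fin r) L} {hU : LinearIndependent L U.col} {hf : restrictTo U f = 0}
    {σ : Fin r → Fin m} :
    pluckerCoord K (fanoMatrix r f) σ ∈ (matrixPoint U hU hf).asHomogeneousIdeal ↔
      (U.submatrix σ id).det = 0 := by
  rw [mem_matrixPoint, evalPlucker_pluckerCoord, Polynomial.monomial_eq_zero_iff]

lemma fanoScheme_ext {x y : fanoScheme r f}
    (h : ∀ b, b ∈ x.asHomogeneousIdeal ↔ b ∈ y.asHomogeneousIdeal) : x = y :=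
  ProjectiveSpectrum.ext (HomogeneousIdeal.ext (Ideal.ext h))

/-- The point given by a matrix depends only on the maximal minors, up to a common factor. -/
lemma matrixPoint_eq_of_minors {L L' : Type u} [Field L] [Algebra K L] [Field L'] [Algebra K L']
    (φ : L →ₐ[K] L') {U : Matrix (Fin m) (Fin r) L} {hU : LinearIndependent L U.col}
    {hf : restrictTo U f = 0} {V : Matrix (Fin m) (Fin r) L'} {hV : LinearIndependent L' V.col}
    {hf' : restrictTo V f = 0} {c : L'}
    (h : ∀ τ : Fin r → Fin m, (V.submatrix τ id).det = c * φ (U.submatrix τ id).det) :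
    matrixPoint V hV hf' = matrixPoint U hU hf := by
  have hc : c ≠ 0 := by
    rintro rfl
    obtain ⟨σ, hσ⟩ := exists_minor_ne_zero V hV
    exact hσ (by rw [h, zero_mul])
  -- The common factor `c` of the minors is absorbed by the substitution `T ↦ c T`, which is
  -- injective because `c ≠ 0`; so both evaluations have the same kernel.
  have key : evalPlucker V hf' = (((Polynomial.aeval (R := L') (Polynomial.C c * Polynomial.X :
      Polynomial L')).restrictScalars K).comp (Polynomial.mapAlgHom φ)).comp
        (evalPlucker U hf) := by
    refine pluckerAlgebra_algHom_ext fun σ => ?_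
    rw [AlgHom.comp_apply, evalPlucker_pluckerCoord, evalPlucker_pluckerCoord, h]
    simp only [AlgHom.comp_apply, Polynomial.coe_mapAlgHom, RingHom.coe_coe,
      Polynomial.map_monomial, AlgHom.restrictScalars_apply, Polynomial.aeval_monomial, pow_one,
      Polynomial.algebraMap_eq]
    rw [← Polynomial.C_mul_X_eq_monomial, map_mul]
    ring
  refine fanoScheme_ext fun b => ?_
  rw [mem_matrixPoint, mem_matrixPoint, key]
  have h1 : ∀ p : Polynomial L, (Polynomial.aeval (R := L')
      (Polynomial.C c * Polynomial.X : Polynomial L')) (Polynomial.map (φ : L →+* L') p) = 0 ↔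
        p = 0 := by
    intro p
    rw [← Polynomial.comp_eq_aeval,
      Polynomial.comp_C_mul_X_eq_zero_iff (mem_nonZeroDivisors_of_ne_zero hc),
      Polynomial.map_eq_zero]
  exact h1 _

lemma matrixPoint_eq_of_eq_mul {L L' : Type u} [Field L] [Algebra K L] [Field L'] [Algebra K L']
    (φ : L →ₐ[K] L') {U : Matrix (Fin m) (Fin r) L} {hU : LinearIndependent L U.col}
    {hf : restrictTo U f = 0} {V : Matrix (Fin m) (Fin r) L'} {hV : LinearIndependent L' V.col}
    {hf' : restrictTo V f = 0} {G : Matrix (Fin r) (Fin r) L'} (h : V = U.map φ * G) :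
    matrixPoint V hV hf' = matrixPoint U hU hf :=
  matrixPoint_eq_of_minors (c := G.det) φ fun τ => by
    rw [h, submatrix_mul_det, map_submatrix_det, mul_comm]

/-- The linear map `b ↦ b T^d` from the component of degree `d` of the Plücker algebra `A`
to `A[T]`. -/
def coactionComponent {S : Type u} [CommRing S] [Algebra K S] (U : Matrix (Fin m) (Fin r) S)
    (d : ℕ) : pluckerGrading K U d →ₗ[K] Polynomial (pluckerAlgebra K U) where
  toFun b := Polynomial.monomial d (b : pluckerAlgebra K U)
  map_add' a b := map_add (Polynomial.monomial d) (a : pluckerAlgebra K U) b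
  map_smul' c b := (Polynomial.smul_monomial c d (b : pluckerAlgebra K U)).symm

/-- The homomorphism from the Plücker algebra `A` to `A[T]` given by its grading. -/
def coaction {S : Type u} [CommRing S] [Algebra K S]
    (U : Matrix (Fin m) (Fin r) S) : pluckerAlgebra K U →ₐ[K] Polynomial (pluckerAlgebra K U) :=
  (DirectSum.toAlgebra K (fun d => pluckerGrading K U d) (coactionComponent U) rfl
    (fun _ _ => (Polynomial.monomial_mul_monomial _ _ _ _).symm)).comp
    (DirectSum.decomposeAlgEquiv (pluckerGrading K U)).toAlgHom

lemma coaction_of_mem {S : Type u} [CommRing S] [Algebra K S] {U : Matrix (Fin m) (Fin r) S}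
    {b : pluckerAlgebra K U} {d : ℕ} (hb : b ∈ pluckerGrading K U d) :
    coaction U b = Polynomial.monomial d b := by
  have h : DirectSum.decomposeAlgEquiv (pluckerGrading K U) b =
      DirectSum.of (fun d => pluckerGrading K U d) d ⟨b, hb⟩ := DirectSum.decompose_of_mem _ hb
  rw [coaction, AlgHom.comp_apply]
  refine (congrArg _ h).trans ?_
  exact DirectSum.toAddMonoid_of (fun d => (coactionComponent U d).toAddMonoidHom) d ⟨b, hb⟩

/-- The matrix of Plücker coordinates that spans the same space as `U` where the minor of the rows
`σ` does not vanish. -/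
def pluckerMatrix (K : Type u) {S : Type u} [CommRing K] [CommRing S] [Algebra K S] {m r : ℕ}
    (U : Matrix (Fin m) (Fin r) S) (σ : Fin r → Fin m) :
    Matrix (Fin m) (Fin r) (pluckerAlgebra K U) :=
  Matrix.of fun i j => pluckerCoord K U (Function.update σ j i)

/-- Cramer's rule in `S[T]`: the matrix of coordinates is `U` times the square matrix `T · adj U_σ`.
Both the equation `f = 0` and the minors follow from this factorisation. -/
lemma pluckerMatrix_map_val {S : Type u} [CommRing S] [Algebra K S]
    (U : Matrix (Fin m) (Fin r) S) (σ : Fin r → Fin m) :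
    (pluckerMatrix K U σ).map (pluckerAlgebra K U).val =
      U.map (Polynomial.CAlgHom (R := K)) * ((Polynomial.X : Polynomial S) •
        ((U.submatrix σ id).adjugate).map (Polynomial.CAlgHom (R := K))) := by
  ext1 i j
  have h3 : (U.map (Polynomial.CAlgHom (R := K)) * ((Polynomial.X : Polynomial S) •
      ((U.submatrix σ id).adjugate).map (Polynomial.CAlgHom (R := K)))) i j =
      Polynomial.X * Polynomial.C ((U.submatrix (Function.update σ j i) id).det) := by
    rw [Matrix.mul_smul, Matrix.smul_apply, smul_eq_mul, ← Matrix.map_mul, Matrix.map_apply,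
      mul_adjugate_submatrix_apply]
    rfl
  rw [h3]
  change Polynomial.monomial 1 _ = _
  rw [← Polynomial.C_mul_X_eq_monomial, mul_comm]

/-- The vanishing is checked in `S[T]`, where the matrix is a right multiple of `U`, and descends
because the Plücker algebra is a subring. -/
lemma restrictTo_pluckerMatrix {S : Type u} [CommRing S] [Algebra K S]
    {U : Matrix (Fin m) (Fin r) S} (hf : restrictTo U f = 0) (σ : Fin r → Fin m) :
    restrictTo (pluckerMatrix K U σ) f = 0 := by
  have h1 : restrictTo (U.map (Polynomial.CAlgHom (R := K))) f = 0 := by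
    rw [← map_restrictTo, hf, map_zero]
  have h2 := restrictTo_mul_eq_zero _ ((Polynomial.X : Polynomial S) •
        ((U.submatrix σ id).adjugate).map (Polynomial.CAlgHom (R := K))) h1
  rw [← pluckerMatrix_map_val, ← map_restrictTo] at h2
  exact (map_eq_zero_iff _ (MvPolynomial.map_injective _ Subtype.val_injective)).mp h2

/-- The adjugate has determinant `(det U_σ) ^ (r - 1)`; multiplying by one more coordinate avoids
the subtraction and covers `r = 0`. -/
lemma det_pluckerMatrix_mul {S : Type u} [CommRing S] [Algebra K S]
    (U : Matrix (Fin m) (Fin r) S) (σ τ : Fin r → Fin m) :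
    ((pluckerMatrix K U σ).submatrix τ id).det * pluckerCoord K U σ =
      pluckerCoord K U τ * pluckerCoord K U σ ^ r := by
  apply Subtype.val_injective
  have h1 : (pluckerAlgebra K U).val (((pluckerMatrix K U σ).submatrix τ id).det) =
      Polynomial.C ((U.submatrix τ id).det) *
        (Polynomial.X ^ r * Polynomial.C ((U.submatrix σ id).adjugate.det)) := by
    rw [← map_submatrix_det, pluckerMatrix_map_val, submatrix_mul_det]
    congr 1
    · exact map_submatrix_det _ _ _
    · rw [Matrix.det_smul, Fintype.card_fin]
      congr 1
      exact map_submatrix_det (Polynomial.CAlgHom (R := K)) (U.submatrix σ id).adjugate id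
  have h2 : (U.submatrix σ id).adjugate.det * (U.submatrix σ id).det =
      (U.submatrix σ id).det ^ r := by
    rw [← Matrix.det_mul, Matrix.adjugate_mul, Matrix.det_smul, Matrix.det_one, Fintype.card_fin,
      mul_one]
  change (pluckerAlgebra K U).val _ * Polynomial.monomial 1 (U.submatrix σ id).det =
    Polynomial.monomial 1 _ * Polynomial.monomial 1 (U.submatrix σ id).det ^ r
  rw [h1, ← Polynomial.C_mul_X_eq_monomial, ← Polynomial.C_mul_X_eq_monomial, mul_pow, ← map_pow,
    ← h2, map_mul]
  ring

lemma exists_algHom_field_ker {A : Type u} [CommRing A] [Algebra K A] (P : Ideal A)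
    [P.IsPrime] : ∃ (L : Type u) (_ : Field L) (_ : Algebra K L) (q : A →ₐ[K] L),
      ∀ a, q a = 0 ↔ a ∈ P := by
  refine ⟨FractionRing (A ⧸ P), inferInstance, inferInstance,
    (IsScalarTower.toAlgHom K (A ⧸ P) (FractionRing (A ⧸ P))).comp (Ideal.Quotient.mkₐ K P),
    fun a => ?_⟩
  change algebraMap (A ⧸ P) (FractionRing (A ⧸ P)) _ = 0 ↔ _
  rw [FaithfulSMul.algebraMap_eq_zero_iff]
  exact Ideal.Quotient.eq_zero_iff_mem

lemma exists_pluckerCoord_notMem (x : fanoScheme r f) :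
    ∃ σ, pluckerCoord K (fanoMatrix r f) σ ∉ x.asHomogeneousIdeal.toIdeal := by
  by_contra! hall
  apply x.not_irrelevant_le
  refine (irrelevant_le_span_pluckerCoord K (fanoMatrix r f)).trans (Ideal.span_le.mpr ?_)
  rintro _ ⟨σ, rfl⟩
  exact hall σ

/-- Every point of the Fano scheme is given by a matrix over some extension field. -/
theorem exists_matrixPoint (x : fanoScheme r f) :
    ∃ (L : Type u) (_ : Field L) (_ : Algebra K L) (U : Matrix (Fin m) (Fin r) L)
      (hU : LinearIndependent L U.col) (hf : restrictTo U f = 0), x = matrixPoint U hU hf := by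
  have hP : x.asHomogeneousIdeal.toIdeal.IsPrime := x.isPrime
  obtain ⟨σ, hσ⟩ := exists_pluckerCoord_notMem x
  obtain ⟨L, _, _, q, hq⟩ := exists_algHom_field_ker (K := K) x.asHomogeneousIdeal.toIdeal
  let p := pluckerCoord K (fanoMatrix r f)
  let N := pluckerMatrix K (fanoMatrix r f) σ
  have hqσ : q (p σ) ≠ 0 := fun h => hσ ((hq _).mp h)
  -- This is `q (p σ) ^ (r - 1)`, the common ratio between the minors of `N.map q` and the
  -- coordinates `q (p τ)`, in a form also valid for `r = 0`.
  let c : L := q (p σ) ^ r / q (p σ)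
  have hc : c ≠ 0 := div_ne_zero (pow_ne_zero _ hqσ) hqσ
  have hdet : ∀ τ, ((N.map q).submatrix τ id).det = c * q (p τ) := by
    intro τ
    have h1 := congrArg q (det_pluckerMatrix_mul (K := K) (fanoMatrix r f) σ τ)
    rw [map_mul, map_mul, map_pow] at h1
    rw [map_submatrix_det, div_mul_eq_mul_div, eq_div_iff hqσ, h1, mul_comm]
  have hU : LinearIndependent L (N.map q).col :=
    linearIndependent_col_of_minor_ne_zero _ (σ := σ) (by rw [hdet]; exact mul_ne_zero hc hqσ)
  have hf : restrictTo (N.map q) f = 0 := by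
    rw [← map_restrictTo, restrictTo_pluckerMatrix (restrictTo_fanoMatrix f), map_zero]
  refine ⟨L, inferInstance, inferInstance, N.map q, hU, hf, ?_⟩
  -- The map `q` forgets the grading and the coaction restores it: in degree `d`, evaluation at the
  -- matrix is `b ↦ c ^ d q(b) T ^ d`.
  have key : evalPlucker (N.map q) hf = (((Polynomial.aeval (R := L)
      (Polynomial.C c * Polynomial.X : Polynomial L)).restrictScalars K).comp
        (Polynomial.mapAlgHom q)).comp (coaction (fanoMatrix r f)) := by
    refine pluckerAlgebra_algHom_ext fun τ => ?_
    rw [AlgHom.comp_apply, evalPlucker_pluckerCoord, hdet,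
      coaction_of_mem (pluckerCoord_mem_one K _ τ)]
    simp only [AlgHom.comp_apply, Polynomial.coe_mapAlgHom, RingHom.coe_coe,
      Polynomial.map_monomial, AlgHom.restrictScalars_apply, Polynomial.aeval_monomial, pow_one,
      Polynomial.algebraMap_eq]
    rw [← Polynomial.C_mul_X_eq_monomial, map_mul]
    ring
  have hhom : ∀ (d : ℕ) (b : pluckerAlgebra K (fanoMatrix r f)), b ∈ pluckerGrading K (fanoMatrix r f) d →
      (evalPlucker (N.map q) hf b = 0 ↔ b ∈ x.asHomogeneousIdeal.toIdeal) := by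
    intro d b hb
    rw [key, AlgHom.comp_apply, coaction_of_mem hb, ← hq]
    simp only [AlgHom.comp_apply, Polynomial.coe_mapAlgHom, RingHom.coe_coe,
      Polynomial.map_monomial, AlgHom.restrictScalars_apply]
    rw [← Polynomial.comp_eq_aeval,
      Polynomial.comp_C_mul_X_eq_zero_iff (mem_nonZeroDivisors_of_ne_zero hc),
      Polynomial.monomial_eq_zero_iff]
  refine fanoScheme_ext fun b => ?_
  -- Both ideals are homogeneous, so comparing homogeneous components suffices.
  have h1 := (x.asHomogeneousIdeal.isHomogeneous).mem_iff (x := b)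
  have h2 := ((matrixPoint (N.map q) hU hf).asHomogeneousIdeal.isHomogeneous).mem_iff (x := b)
  refine h1.trans (Iff.trans ?_ h2.symm)
  refine forall_congr' fun d => ?_
  exact (hhom d _ (SetLike.coe_mem _)).symm

lemma le_iff_specializes {x y : fanoScheme r f} :
    x.asHomogeneousIdeal ≤ y.asHomogeneousIdeal ↔ y ∈ closure {x} :=
  ProjectiveSpectrum.le_iff_mem_closure _ x y

/-- A specialization of a rational point has proportional minors. -/
lemma exists_minors_eq_mul {L : Type u} [Field L] [Algebra K L] {U : Matrix (Fin m) (Fin r) K}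
    {hU : LinearIndependent K U.col} {hf : restrictTo U f = 0} {V : Matrix (Fin m) (Fin r) L}
    {hV : LinearIndependent L V.col} {hf' : restrictTo V f = 0}
    (h : (matrixPoint U hU hf).asHomogeneousIdeal ≤ (matrixPoint V hV hf').asHomogeneousIdeal) :
    ∃ c : L, ∀ τ : Fin r → Fin m,
      (V.submatrix τ id).det = c * Algebra.ofId K L (U.submatrix τ id).det := by
  obtain ⟨σ, hσ⟩ := exists_minor_ne_zero U hU
  refine ⟨(V.submatrix σ id).det * (Algebra.ofId K L (U.submatrix σ id).det)⁻¹, fun τ => ?_⟩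
  let a : K := (U.submatrix τ id).det / (U.submatrix σ id).det
  -- Rationality enters here: the ratio `a` of two minors lies in `K`, so this linear relation is an
  -- element of the homogeneous coordinate ring and passes to the specialization.
  have h1 : pluckerCoord K (fanoMatrix r f) τ - a • pluckerCoord K (fanoMatrix r f) σ ∈
      (matrixPoint U hU hf).asHomogeneousIdeal := by
    rw [mem_matrixPoint, map_sub, map_smul, evalPlucker_pluckerCoord, evalPlucker_pluckerCoord,
      Polynomial.smul_monomial, smul_eq_mul, div_mul_cancel₀ _ hσ, sub_self]
  have h2 := h h1
  rw [mem_matrixPoint, map_sub, map_smul, evalPlucker_pluckerCoord, evalPlucker_pluckerCoord,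
      Polynomial.smul_monomial, ← map_sub, Polynomial.monomial_eq_zero_iff, sub_eq_zero] at h2
  rw [h2, Algebra.smul_def, map_div₀]
  change _ / _ * _ = _ * (algebraMap K L _)⁻¹ * algebraMap K L _
  ring

/-- Rational points are closed. -/
lemma isClosed_matrixPoint {U : Matrix (Fin m) (Fin r) K} {hU : LinearIndependent K U.col}
    {hf : restrictTo U f = 0} : IsClosed {matrixPoint U hU hf} := by
  rw [← closure_subset_iff_isClosed]
  intro y hy
  rw [← le_iff_specializes] at hy
  obtain ⟨L, _, _, V, hV, hf', rfl⟩ := exists_matrixPoint y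
  obtain ⟨c, hc⟩ := exists_minors_eq_mul hy
  exact matrixPoint_eq_of_minors (Algebra.ofId K L) hc

lemma span_le_of_matrixPoint_eq {U V : Matrix (Fin m) (Fin r) K} {hU : LinearIndependent K U.col}
    {hf : restrictTo U f = 0} {hV : LinearIndependent K V.col} {hf' : restrictTo V f = 0}
    (h : matrixPoint U hU hf = matrixPoint V hV hf') :
    Submodule.span K (Set.range V.col) ≤ Submodule.span K (Set.range U.col) := by
  obtain ⟨c, hc⟩ := exists_minors_eq_mul (le_of_eq (congrArg
    (fun x : fanoScheme r f => x.asHomogeneousIdeal) h))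
  obtain ⟨G, rfl⟩ := exists_eq_mul_of_minors U V hV hc
  rw [Submodule.span_le]
  rintro _ ⟨j, rfl⟩
  have : (U * G).col j = ∑ k, G k j • U.col k := by
    funext i
    simp [Matrix.col, Matrix.mul_apply, mul_comm]
  rw [this]
  exact sum_mem fun k _ => Submodule.smul_mem _ _ (Submodule.subset_span ⟨k, rfl⟩)

/-- A row of a matrix that gives the point `x` vanishes if and only if the Plücker coordinates that
involve this row vanish at `x`. -/
lemma row_eq_zero_iff {L : Type u} [Field L] [Algebra K L] {U : Matrix (Fin m) (Fin r) L}
    {hU : LinearIndependent L U.col} {hf : restrictTo U f = 0} {i : Fin m} :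
    U i = 0 ↔ ∀ τ : Fin r → Fin m, i ∈ Set.range τ →
      pluckerCoord K (fanoMatrix r f) τ ∈ (matrixPoint U hU hf).asHomogeneousIdeal := by
  simp_rw [pluckerCoord_mem_matrixPoint]
  refine ⟨?_, row_eq_zero_of_minors U hU i⟩
  rintro h τ ⟨k, rfl⟩
  exact Matrix.det_eq_zero_of_row_eq_zero k fun j => congrFun h j

end Points

/-! ### Closed immersions between `Proj`s -/

section Proj

open HomogeneousLocalization HomogeneousIdeal GradedFunLike

variable {A B σ τ : Type u} [CommRing A] [SetLike σ A] [AddSubgroupClass σ A]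
  [CommRing B] [SetLike τ B] [AddSubgroupClass τ B] {𝒜 : ℕ → σ} {ℬ : ℕ → τ}
  [GradedRing 𝒜] [GradedRing ℬ]

lemma exists_preimage_mem_of_surjective (g : 𝒜 →+*ᵍ ℬ) (hg : Function.Surjective g) {d : ℕ}
    {b : B} (hb : b ∈ ℬ d) : ∃ a ∈ 𝒜 d, g a = b := by
  obtain ⟨a, rfl⟩ := hg b
  refine ⟨DirectSum.decompose 𝒜 a d, SetLike.coe_mem _, ?_⟩
  rw [map_directSumDecompose (𝒜 := 𝒜) (ℬ := ℬ), DirectSum.decompose_of_mem_same _ hb]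

lemma irrelevant_le_map_of_surjective (g : 𝒜 →+*ᵍ ℬ) (hg : Function.Surjective g) :
    ℬ₊ ≤ 𝒜₊.map g := by
  refine (toIdeal_irrelevant_le _).mpr fun i hi b hb => ?_
  obtain ⟨a, ha, rfl⟩ := exists_preimage_mem_of_surjective g hg hb
  refine Ideal.mem_map_of_mem _ ?_
  exact DirectSum.decompose_of_mem_ne _ ha hi.ne'

lemma awayMap_surjective (g : 𝒜 →+*ᵍ ℬ) (hg : Function.Surjective g) {d : ℕ} {s : A}
    (hs : s ∈ 𝒜 d) : Function.Surjective (Away.map g s : Away 𝒜 s →+* Away ℬ (g s)) := by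
  intro x
  obtain ⟨n, b, hb, rfl⟩ := Away.mk_surjective ℬ (map_mem g hs) x
  obtain ⟨a, ha, rfl⟩ := exists_preimage_mem_of_surjective g hg hb
  exact ⟨Away.mk 𝒜 hs n a ha, Away.map_mk g s hs n a ha⟩

/-- The claim is local on the target. The preimage of the chart of `s` is the chart of `g s`, and
there the map is `Spec` of the surjection `awayMap_surjective`. -/
lemma isClosedImmersion_projMap (g : 𝒜 →+*ᵍ ℬ) (hg : Function.Surjective g) :
    IsClosedImmersion (Proj.map g (irrelevant_le_map_of_surjective g hg)) := by
  rw [IsZariskiLocalAtTarget.iff_of_openCover (P := @IsClosedImmersion)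
    (Proj.affineOpenCover 𝒜).openCover]
  rintro ⟨d, s⟩
  have hs : (s : A) ∈ 𝒜 d := s.2
  have hd : 0 < (d : ℕ) := d.pos
  have H : IsPullback (Spec.map (CommRingCat.ofHom (Away.map g (s : A))))
      (Proj.awayι ℬ (g s) (map_mem g hs) hd) (Proj.awayι 𝒜 (s : A) hs hd)
      (Proj.map g (irrelevant_le_map_of_surjective g hg)) := by
    have : IsOpenImmersion (Proj.awayι ℬ (g s) (map_mem g hs) hd) := inferInstance
    have : IsOpenImmersion (Proj.awayι 𝒜 (s : A) hs hd) := inferInstance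
    refine IsOpenImmersion.isPullback _ _ _ _ (Proj.awayι_comp_map g _ hd s hs) ?_
    rw [Proj.opensRange_awayι, Proj.opensRange_awayι, Proj.map_preimage_basicOpen]
  have hc : IsClosedImmersion (Spec.map (CommRingCat.ofHom (Away.map g (s : A)))) :=
    IsClosedImmersion.spec_of_surjective _ (awayMap_surjective g hg hs)
  change IsClosedImmersion (Limits.pullback.snd _ (Proj.awayι 𝒜 (s : A) hs hd))
  rw [← MorphismProperty.cancel_left_of_respectsIso @IsClosedImmersion
    H.flip.isoPullback.hom, IsPullback.isoPullback_hom_snd]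
  exact hc

/-- The rings of the charts are subrings of localizations of the domain `B`. -/
lemma isReduced_proj [IsDomain B] : AlgebraicGeometry.IsReduced (Proj ℬ) := by
  have : ∀ i, AlgebraicGeometry.IsReduced ((Proj.affineOpenCover ℬ).openCover.X i) := by
    rintro ⟨d, s⟩
    change AlgebraicGeometry.IsReduced (Spec (.of (Away ℬ (s : B))))
    have : _root_.IsReduced (Away ℬ (s : B)) := by
      have h1 : _root_.IsReduced (Localization (Submonoid.powers (s : B))) :=
        inferInstance
      exact isReduced_of_injective (algebraMap _ (Localization (Submonoid.powers (s : B))))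
        (val_injective _)
    infer_instance
  exact IsReduced.of_openCover _ (Proj.affineOpenCover ℬ).openCover

/-- A homogeneous prime that contains the kernel is the preimage of its image, and that image is
again prime; it misses part of the irrelevant ideal because `g` maps the irrelevant ideal into the
irrelevant ideal. -/
lemma mem_range_projMap_iff (g : 𝒜 →+*ᵍ ℬ) (hg : Function.Surjective g) (x : Proj 𝒜) :
    x ∈ Set.range (Proj.map g (irrelevant_le_map_of_surjective g hg)) ↔
      ∀ a, g a = 0 → a ∈ x.asHomogeneousIdeal := by
  constructor
  · rintro ⟨y, rfl⟩ a ha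
    change g a ∈ y.asHomogeneousIdeal
    rw [ha]
    exact zero_mem _
  · intro h
    have hker : RingHom.ker (g : A →+* B) ≤ x.asHomogeneousIdeal.toIdeal := h
    have hprime : x.asHomogeneousIdeal.toIdeal.IsPrime := x.isPrime
    have hcomap : ∀ a, g a ∈ (x.asHomogeneousIdeal.map g).toIdeal ↔
        a ∈ x.asHomogeneousIdeal.toIdeal := by
      intro a
      have h1 := Ideal.comap_map_of_surjective (g : A →+* B) hg x.asHomogeneousIdeal.toIdeal
      have h2 : a ∈ Ideal.comap (g : A →+* B)
          (Ideal.map (g : A →+* B) x.asHomogeneousIdeal.toIdeal) ↔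
            a ∈ x.asHomogeneousIdeal.toIdeal := by
        rw [h1]
        change a ∈ _ ⊔ RingHom.ker (g : A →+* B) ↔ _
        rw [sup_eq_left.mpr hker]
      exact h2
    let y : ProjectiveSpectrum ℬ :=
      ⟨x.asHomogeneousIdeal.map g, Ideal.map_isPrime_of_surjective (f := (g : A →+* B)) hg hker,
        fun hle => x.not_irrelevant_le (fun a ha => by
          refine (hcomap a).mp (hle ?_)
          change (DirectSum.decompose ℬ (g a) 0 : B) = 0
          rw [← map_directSumDecompose (𝒜 := 𝒜) (ℬ := ℬ)]
          exact (congrArg g ha).trans (map_zero g))⟩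
    exact ⟨y, ProjectiveSpectrum.ext (HomogeneousIdeal.ext (Ideal.ext hcomap))⟩

/-- A reduced closed subscheme is determined by its underlying set. -/
lemma ker_eq_vanishingIdeal {X Y : Scheme.{u}} (g : Y ⟶ X) [AlgebraicGeometry.IsReduced Y]
    (Z : TopologicalSpace.Closeds X) (hZ : Set.range g = Z) :
    g.ker = Scheme.IdealSheafData.vanishingIdeal Z := by
  -- On the reduced scheme `Y` the vanishing ideal of the whole space is zero, and the zero ideal
  -- maps to the kernel of `g`.
  have h := Scheme.IdealSheafData.map_vanishingIdeal g ⊤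
  rw [Scheme.IdealSheafData.vanishingIdeal_top, Scheme.nilradical_eq_bot,
    Scheme.IdealSheafData.map_bot] at h
  rw [h]
  congr 1
  apply TopologicalSpace.Closeds.ext
  simp [Set.image_univ, hZ, Z.isClosed.closure_eq]

/-- Closed immersions with the same kernel are isomorphic over their target, hence over `Spec K`. -/
lemma nonempty_reducedClosed_iso {K : Type u} [Field K] {X Y : Scheme.{u}} (p : X ⟶ Spec (.of K))
    (g : Y ⟶ X) [IsClosedImmersion g] [AlgebraicGeometry.IsReduced Y]
    (Z : TopologicalSpace.Closeds X) (hZ : Set.range g = Z) :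
    Nonempty (reducedClosed p Z ≅ Over.mk (g ≫ p)) := by
  have h : (Scheme.IdealSheafData.vanishingIdeal Z).subschemeι.ker = g.ker := by
    rw [ker_eq_vanishingIdeal g Z hZ, Scheme.IdealSheafData.ker_subschemeι]
  let I := Scheme.IdealSheafData.vanishingIdeal Z
  have : IsIso (IsClosedImmersion.lift I.subschemeι g h.le) :=
    IsClosedImmersion.isIso_lift I.subschemeι g h
  let e : Y ≅ I.subscheme := asIso (IsClosedImmersion.lift I.subschemeι g h.le)
  have he : e.hom ≫ I.subschemeι = g := IsClosedImmersion.lift_fac _ _ _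
  have he' : e.inv ≫ g ≫ p = I.subschemeι ≫ p := by
    rw [Iso.inv_comp_eq, ← Category.assoc, he]
  exact ⟨Over.isoMk e.symm he'⟩

/-- Makes the isomorphism of components one over `K`. A graded ring homomorphism need not be
`K`-linear, hence `hK`; on each chart the claim is an identity between fractions `c / 1`. -/
lemma projMap_toSpecZero {K : Type u} [Field K] {A B : Type u} [CommRing A] [CommRing B]
    [Algebra K A] [Algebra K B] {𝒜 : ℕ → Submodule K A} {ℬ : ℕ → Submodule K B}
    [GradedAlgebra 𝒜] [GradedAlgebra ℬ] (g : 𝒜 →+*ᵍ ℬ) (hg : ℬ₊ ≤ 𝒜₊.map g)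
    (hK : ∀ c : K, g (algebraMap K A c) = algebraMap K B c) :
    Proj.map g hg ≫ Proj.toSpecZero 𝒜 ≫ Spec.map (CommRingCat.ofHom (algebraMap K (𝒜 0))) =
      Proj.toSpecZero ℬ ≫ Spec.map (CommRingCat.ofHom (algebraMap K (ℬ 0))) := by
  refine (Proj.mapAffineOpenCover g hg).openCover.hom_ext _ _ ?_
  rintro ⟨d, s⟩
  have hd : 0 < (d : ℕ) := d.pos
  have hs : (s : A) ∈ 𝒜 d := s.2
  change Proj.awayι ℬ (g (s : A)) (map_mem g hs) hd ≫ Proj.map g hg ≫ Proj.toSpecZero 𝒜 ≫ _ =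
    Proj.awayι ℬ (g (s : A)) (map_mem g hs) hd ≫ Proj.toSpecZero ℬ ≫ _
  rw [Proj.awayι_comp_map_assoc g hg hd s hs, Proj.awayι_toSpecZero_assoc,
    Proj.awayι_toSpecZero_assoc, ← Spec.map_comp, ← Spec.map_comp, ← Spec.map_comp]
  congr 1
  ext c
  change Localization.mk (g (algebraMap K A c)) (⟨g 1, _⟩ : Submonoid.powers (g (s : A))) =
    Localization.mk (algebraMap K B c) (⟨1, _⟩ : Submonoid.powers (g (s : A)))
  simp only [hK, map_one]

end Proj

/-! ### Planes in the elementary symmetric hypersurface -/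

/-- The restriction of the `i`-th coordinate to the column space of `U`. -/
def rowForm {S : Type u} [CommRing S] {m r : ℕ} (U : Matrix (Fin m) (Fin r) S) (i : Fin m) :
    MvPolynomial (Fin r) S :=
  ∑ j, MvPolynomial.C (U i j) * MvPolynomial.X j

lemma coeff_rowForm {S : Type u} [CommRing S] {m r : ℕ} (U : Matrix (Fin m) (Fin r) S)
    (i : Fin m) (j : Fin r) : (rowForm U i).coeff (Finsupp.single j 1) = U i j := by
  classical
  simp [rowForm, MvPolynomial.coeff_sum, MvPolynomial.coeff_C_mul, MvPolynomial.coeff_X,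
    Finsupp.single_left_inj]

lemma rowForm_eq_zero_iff {S : Type u} [CommRing S] {m r : ℕ} {U : Matrix (Fin m) (Fin r) S}
    {i : Fin m} : rowForm U i = 0 ↔ U i = 0 := by
  constructor
  · intro h
    funext j
    have h1 := coeff_rowForm U i j
    rw [h, MvPolynomial.coeff_zero] at h1
    exact h1.symm
  · intro h
    have h' : ∀ j, U i j = 0 := fun j => congrFun h j
    simp [rowForm, h']

lemma rowForm_of_row_eq_smul {S : Type u} [CommRing S] {m r : ℕ} {U : Matrix (Fin m) (Fin r) S}
    {i k : Fin m} {c : S} (h : ∀ j, U k j = c * U i j) :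
    rowForm U k = MvPolynomial.C c * rowForm U i := by
  simp [rowForm, h, Finset.mul_sum, mul_assoc]

/-- The sets of size `m - 1` are the complements of single indices, except for `m = 0`, where the
truncated subtraction gives `e_0 = 1`. -/
lemma restrictTo_esymm {K S : Type u} [CommRing K] [CommRing S] [Algebra K S] {m r : ℕ}
    (U : Matrix (Fin m) (Fin r) S) :
    restrictTo U (MvPolynomial.esymm (Fin m) K (m - 1)) =
      if m = 0 then 1 else ∑ i, ∏ j ∈ Finset.univ.erase i, rowForm U j := by
  rw [restrictTo, MvPolynomial.esymm, map_sum]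
  simp only [map_prod, MvPolynomial.aeval_X]
  split_ifs with hm
  · subst hm
    simp
  · symm
    refine Finset.sum_bij (fun i _ => Finset.univ.erase i) ?_ ?_ ?_ (fun _ _ => rfl)
    · intro i _
      simp [Finset.mem_powersetCard]
    · intro i _ j _ h
      by_contra hij
      have : i ∈ Finset.univ.erase j := by simp [hij]
      rw [← h] at this
      simp at this
    · intro t ht
      rw [Finset.mem_powersetCard] at ht
      have h1 : tᶜ.card = 1 := by
        rw [Finset.card_compl, Fintype.card_fin, ht.2]
        lia
      obtain ⟨i, hi⟩ := Finset.card_eq_one.mp h1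
      refine ⟨i, Finset.mem_univ _, ?_⟩
      rw [← compl_compl t, hi]
      ext a
      simp

/-! ### Divisibility among the linear forms over a field -/

section Field

variable {L : Type u} [Field L] {m r : ℕ} {U : Matrix (Fin m) (Fin r) L}

/-- A nonzero linear form over a field is irreducible for degree reasons, and the polynomial ring is
factorial. -/
lemma prime_rowForm {i : Fin m} (h : U i ≠ 0) : Prime (rowForm U i) := by
  have h0 : rowForm U i ≠ 0 := fun h' => h (rowForm_eq_zero_iff.mp h')
  have hhom : (rowForm U i).IsHomogeneous 1 :=
    MvPolynomial.IsHomogeneous.sum _ _ _ fun j _ => MvPolynomial.isHomogeneous_C_mul_X _ _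
  refine Irreducible.prime
    (MvPolynomial.irreducible_of_totalDegree_eq_one (hhom.totalDegree h0) fun x hx => ?_)
  refine isUnit_iff_ne_zero.mpr ?_
  rintro rfl
  refine h0 (MvPolynomial.ext _ _ fun d => ?_)
  rw [MvPolynomial.coeff_zero]
  exact zero_dvd_iff.mp (hx d)

lemma exists_eq_mul_of_rowForm_dvd {i k : Fin m} (hi : U i ≠ 0) (hk : U k ≠ 0)
    (h : rowForm U i ∣ rowForm U k) : ∃ c : L, ∀ j, U k j = c * U i j := by
  obtain ⟨u, hu⟩ := (prime_rowForm hi).irreducible.associated_of_dvd (prime_rowForm hk).irreducible h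
  obtain ⟨c, -, hc⟩ := MvPolynomial.isUnit_iff_eq_C_of_isReduced.mp u.isUnit
  refine ⟨c, fun j => ?_⟩
  rw [← coeff_rowForm U k, ← hu, hc, mul_comm, MvPolynomial.coeff_C_mul, coeff_rowForm]

/-- All summands except the `i`-th contain the factor `ℓ_i`, so the prime `ℓ_i` also divides the
`i`-th one, the product of the other forms. -/
lemma exists_ne_rowForm_dvd {i : Fin m} (hi : U i ≠ 0)
    (h : ∑ i, ∏ j ∈ Finset.univ.erase i, rowForm U j = 0) :
    ∃ j ≠ i, rowForm U i ∣ rowForm U j := by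
  have h1 : rowForm U i ∣ ∏ j ∈ Finset.univ.erase i, rowForm U j := by
    rw [← Finset.add_sum_erase _ _ (Finset.mem_univ i)] at h
    rw [eq_neg_of_add_eq_zero_left h, dvd_neg]
    refine Finset.dvd_sum fun k hk => Finset.dvd_prod_of_mem _ ?_
    simpa using (Finset.ne_of_mem_erase hk).symm
  obtain ⟨j, hj, hd⟩ := (prime_rowForm hi).dvd_finsetProd_iff _ |>.mp h1
  exact ⟨j, Finset.ne_of_mem_erase hj, hd⟩

lemma exists_ne_row_eq_zero {i : Fin m} (hi : U i = 0)
    (h : ∑ i, ∏ j ∈ Finset.univ.erase i, rowForm U j = 0) : ∃ j ≠ i, U j = 0 := by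
  rw [← Finset.add_sum_erase _ _ (Finset.mem_univ i), Finset.sum_eq_zero, add_zero,
    Finset.prod_eq_zero_iff] at h
  · obtain ⟨j, hj, hj0⟩ := h
    exact ⟨j, Finset.ne_of_mem_erase hj, rowForm_eq_zero_iff.mp hj0⟩
  · intro k hk
    refine Finset.prod_eq_zero (i := i) ?_ (rowForm_eq_zero_iff.mpr hi)
    simpa using (Finset.ne_of_mem_erase hk).symm

/-- If the `i`-th form is proportional to the `j`-th form only, then the two forms are opposite. -/
lemma row_eq_neg {i j : Fin m} (hij : j ≠ i) (hne : ∀ k, U k ≠ 0)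
    (hdvd : rowForm U i ∣ rowForm U j) (honly : ∀ k, rowForm U i ∣ rowForm U k → k = i ∨ k = j)
    (h : ∑ i, ∏ j ∈ Finset.univ.erase i, rowForm U j = 0) : U j = -U i := by
  obtain ⟨c, hc⟩ := exists_eq_mul_of_rowForm_dvd (hne i) (hne j) hdvd
  have hform := rowForm_of_row_eq_smul hc
  let Q := ∏ k ∈ (Finset.univ.erase i).erase j, rowForm U k
  have hi : ∏ k ∈ Finset.univ.erase i, rowForm U k = rowForm U j * Q :=
    (Finset.mul_prod_erase _ _ (by simpa using hij)).symm
  have hj : ∏ k ∈ Finset.univ.erase j, rowForm U k = rowForm U i * Q := by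
    rw [← Finset.mul_prod_erase _ _ (show i ∈ Finset.univ.erase j by simpa using hij.symm),
      Finset.erase_right_comm]
  have hrest : ∀ k ∈ (Finset.univ.erase i).erase j,
      rowForm U i * rowForm U j ∣ ∏ l ∈ Finset.univ.erase k, rowForm U l := by
    intro k hk
    have hki : i ≠ k := by rintro rfl; simp at hk
    have hkj : j ≠ k := by rintro rfl; simp at hk
    rw [← Finset.mul_prod_erase _ _ (show i ∈ Finset.univ.erase k by simpa using hki),
      ← Finset.mul_prod_erase _ _ (show j ∈ (Finset.univ.erase k).erase i by simp [hij, hkj]),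
      ← mul_assoc]
    exact dvd_mul_right _ _
  rw [← Finset.add_sum_erase _ _ (Finset.mem_univ i),
    ← Finset.add_sum_erase _ _ (show j ∈ Finset.univ.erase i by simpa using hij), hi, hj,
    ← add_assoc] at h
  have h1 : rowForm U i * rowForm U j ∣ rowForm U j * Q + rowForm U i * Q := by
    rw [eq_neg_of_add_eq_zero_left h, dvd_neg]
    exact Finset.dvd_sum hrest
  have hp := prime_rowForm (hne i)
  -- With `ℓ_j = c ℓ_i`, the two special summands add up to `(c + 1) ℓ_i Q`, while all other
  -- summands are divisible by `ℓ_i ^ 2`; one factor `ℓ_i` cancels.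
  have h2 : rowForm U i ∣ MvPolynomial.C (c + 1) * Q := by
    rw [hform] at h1
    have h3 : rowForm U i * rowForm U i ∣ rowForm U i * (MvPolynomial.C (c + 1) * Q) := by
      refine (dvd_trans ⟨MvPolynomial.C c, by ring⟩ h1).trans (dvd_of_eq ?_)
      rw [map_add, map_one]
      ring
    exact (mul_dvd_mul_iff_left hp.ne_zero).mp h3
  -- Otherwise `ℓ_i` divides a unit or one of the factors of `Q`, and `Q` omits the only two forms
  -- that `ℓ_i` divides.
  have hc1 : c + 1 = 0 := by
    by_contra hc1
    rcases hp.dvd_or_dvd h2 with h3 | h3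
    · exact hp.not_isUnit (isUnit_of_dvd_unit h3 ((isUnit_iff_ne_zero.mpr hc1).map _))
    · obtain ⟨k, hk, hkd⟩ := hp.dvd_finsetProd_iff _ |>.mp h3
      rcases honly k hkd with rfl | rfl <;> simp at hk
  funext l
  rw [hc, eq_neg_of_add_eq_zero_left hc1]
  simp

/-- A plane of dimension `n` in `L^(2n)` inside the hypersurface and on which no coordinate
vanishes is the space of a perfect matching. -/
lemma exists_involution_of_row_ne_zero {n : ℕ} {U : Matrix (Fin (2 * n)) (Fin n) L}
    (hU : LinearIndependent L U.col) (hne : ∀ k, U k ≠ 0)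
    (h : ∑ i, ∏ j ∈ Finset.univ.erase i, rowForm U j = 0) :
    ∃ p : Fin (2 * n) → Fin (2 * n), Function.Involutive p ∧ (∀ a, p a ≠ a) ∧
      ∀ a, U (p a) = -U a := by
  classical
  let s : Setoid (Fin (2 * n)) :=
    { r := fun i k => rowForm U i ∣ rowForm U k
      iseqv := ⟨fun _ => dvd_rfl, fun {i k} hik => ((prime_rowForm (hne i)).irreducible.dvd_symm
        (prime_rowForm (hne k)).irreducible hik), fun h1 h2 => h1.trans h2⟩ }
  let F : Quotient s → Finset (Fin (2 * n)) := fun q => Finset.univ.filter fun i => ⟦i⟧ = q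
  have hF2 : ∀ q, 2 ≤ (F q).card := by
    intro q
    obtain ⟨i, rfl⟩ := Quotient.exists_rep q
    obtain ⟨j, hji, hd⟩ := exists_ne_rowForm_dvd (hne i) h
    refine Finset.one_lt_card.mpr ⟨i, by simp [F], j, ?_, hji.symm⟩
    simp only [F, Finset.mem_filter, Finset.mem_univ, true_and]
    exact Quotient.sound (s.symm hd)
  have hsum : ∑ q, (F q).card = 2 * n := by
    have := Finset.card_eq_sum_card_fiberwise (s := (Finset.univ : Finset (Fin (2 * n))))
      (t := Finset.univ) (f := fun i => (⟦i⟧ : Quotient s)) (fun _ _ => by simp)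
    simpa [F] using this.symm
  -- One row from each proportionality class already spans the row space, which has dimension `n`.
  have hcard : n ≤ Fintype.card (Quotient s) := by
    have hrank : U.rank = n := by
      rw [Matrix.rank_eq_finrank_span_cols, finrank_span_eq_card hU, Fintype.card_fin]
    refine hrank.symm.le.trans ?_
    rw [Matrix.rank_eq_finrank_span_row]
    have hle : Submodule.span L (Set.range U.row) ≤
        Submodule.span L (Set.range fun q : Quotient s => U.row q.out) := by
      rw [Submodule.span_le]
      rintro _ ⟨k, rfl⟩
      have hd : rowForm U (⟦k⟧ : Quotient s).out ∣ rowForm U k := Quotient.mk_out (s := s) k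
      obtain ⟨c, hc⟩ := exists_eq_mul_of_rowForm_dvd (hne _) (hne k) hd
      have : U.row k = c • U.row (⟦k⟧ : Quotient s).out := funext hc
      rw [this]
      exact Submodule.smul_mem _ _ (Submodule.subset_span ⟨_, rfl⟩)
    exact (Submodule.finrank_mono hle).trans (finrank_range_le_card _)
  have hF : ∀ q, (F q).card = 2 := by
    -- At least `n` classes of size at least two share `2n` indices, so equality holds for each
    -- class.
    have h1 : ∑ q : Quotient s, 2 = ∑ q, (F q).card := by
      refine le_antisymm (Finset.sum_le_sum fun q _ => hF2 q) ?_
      rw [hsum, Finset.sum_const, Finset.card_univ, smul_eq_mul]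
      lia
    exact fun q => ((Finset.sum_eq_sum_iff_of_le fun q _ => hF2 q).mp h1 q (Finset.mem_univ _)).symm
  have hpair : ∀ i, ∃ j, j ≠ i ∧ F (Quotient.mk s i) = {i, j} := by
    intro i
    obtain ⟨a, b, hab, hFab⟩ := Finset.card_eq_two.mp (hF (Quotient.mk s i))
    have hi : i ∈ F (Quotient.mk s i) := by simp [F]
    rw [hFab, Finset.mem_insert, Finset.mem_singleton] at hi
    rcases hi with rfl | rfl
    · exact ⟨b, hab.symm, hFab⟩
    · exact ⟨a, hab, by rw [hFab, Finset.pair_comm]⟩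
  choose p hp hFp using hpair
  have hmem : ∀ i k, rowForm U i ∣ rowForm U k ↔ k = i ∨ k = p i := by
    intro i k
    have h1 : k ∈ F (Quotient.mk s i) ↔ rowForm U i ∣ rowForm U k := by
      simp only [F, Finset.mem_filter, Finset.mem_univ, true_and]
      rw [eq_comm]
      exact Quotient.eq (r := s)
    rw [← h1, hFp, Finset.mem_insert, Finset.mem_singleton]
  refine ⟨p, fun a => ?_, hp, fun a => ?_⟩
  · have h1 : rowForm U (p a) ∣ rowForm U a := s.symm ((hmem a (p a)).mpr (Or.inr rfl))
    exact (((hmem _ _).mp h1).resolve_left (hp a).symm).symm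
  · exact row_eq_neg (hp a) hne ((hmem a _).mpr (Or.inr rfl)) (fun k => (hmem a k).mp) h

end Field

/-! ### Spaces of perfect matchings -/

/-- `e` selects one element of every pair of the involution `p`. -/
structure IsTransversal {m n : ℕ} (p : Fin m → Fin m) (e : Fin n → Fin m) : Prop where
  injective : Function.Injective e
  ne_apply : ∀ j k, e j ≠ p (e k)
  exists_eq : ∀ a, ∃ j, a = e j ∨ a = p (e j)

/-- The smaller element of each pair is selected; `p` exchanges the selected set with its
complement, so it has `n` elements. -/
lemma exists_isTransversal {n : ℕ} {p : Fin (2 * n) → Fin (2 * n)} (hp : Function.Involutive p)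
    (hne : ∀ a, p a ≠ a) : ∃ e : Fin n → Fin (2 * n), IsTransversal p e := by
  let s : Finset (Fin (2 * n)) := Finset.univ.filter fun a => a < p a
  have hs : s.card = n := by
    have h1 : sᶜ.card = s.card := by
      refine Finset.card_bij (fun a _ => p a) ?_ (fun a _ b _ hab => hp.injective hab) ?_
      · intro a ha
        simp only [s, Finset.mem_compl, Finset.mem_filter, Finset.mem_univ, true_and, not_lt,
          hp a] at ha ⊢
        exact lt_of_le_of_ne ha (hne a)
      · intro b hb
        refine ⟨p b, ?_, hp b⟩
        simp only [s, Finset.mem_compl, Finset.mem_filter, Finset.mem_univ, true_and, not_lt,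
          hp b] at hb ⊢
        exact hb.le
    have h2 := Finset.card_add_card_compl s
    rw [Fintype.card_fin] at h2
    lia
  let e : Fin n ≃ s := (Finset.equivFinOfCardEq hs).symm
  have he : ∀ j, (e j : Fin (2 * n)) < p (e j) := fun j =>
    (Finset.mem_filter.mp (e j).2).2
  refine ⟨fun j => e j, fun j k hjk => e.injective (Subtype.ext hjk), fun j k hjk => ?_,
    fun a => ?_⟩
  · have h1 := he j
    rw [hjk, hp] at h1
    exact lt_asymm h1 (he k)
  · by_cases ha : a < p a
    · exact ⟨e.symm ⟨a, by simp [s, ha]⟩, by simp⟩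
    · have hpa : p a < p (p a) := by
        rw [hp]
        exact lt_of_le_of_ne (not_lt.mp ha) (hne a)
      exact ⟨e.symm ⟨p a, by simp [s, hpa]⟩, by simp [hp a]⟩

/-- A matrix whose columns are a basis of the space `x_a + x_(p a) = 0`. -/
def matchingMatrix (S : Type u) [CommRing S] {m n : ℕ} (p : Fin m → Fin m) (e : Fin n → Fin m) :
    Matrix (Fin m) (Fin n) S :=
  Matrix.of fun a j => if a = e j then 1 else if a = p (e j) then -1 else 0

section Matching

variable {S : Type u} [CommRing S] {m n : ℕ} {p : Fin m → Fin m} {e : Fin n → Fin m}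

lemma matchingMatrix_apply_transversal (he : IsTransversal p e) (k j : Fin n) :
    matchingMatrix S p e (e k) j = (1 : Matrix (Fin n) (Fin n) S) k j := by
  simp [matchingMatrix, he.injective.eq_iff, he.ne_apply, Matrix.one_apply]

lemma matchingMatrix_apply_involution (hp : Function.Involutive p) (he : IsTransversal p e)
    (a : Fin m) (j : Fin n) : matchingMatrix S p e (p a) j = -matchingMatrix S p e a j := by
  have key : ∀ k, matchingMatrix S p e (p (e k)) j = -matchingMatrix S p e (e k) j := by
    intro k
    simp only [matchingMatrix, Matrix.of_apply, (he.ne_apply _ _).symm, if_false,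
      hp.injective.eq_iff, he.injective.eq_iff, he.ne_apply]
    split_ifs <;> simp
  obtain ⟨k, rfl | rfl⟩ := he.exists_eq a
  · exact key k
  · rw [hp, key, neg_neg]

lemma matchingMatrix_submatrix (he : IsTransversal p e) :
    (matchingMatrix S p e).submatrix e id = 1 := by
  ext k j
  exact matchingMatrix_apply_transversal he k j

/-- Rows that are opposite along `p` are determined by the rows in `e`, where `matchingMatrix` is
the identity. Thus any such matrix, over any ring, factors through the standard one. -/
lemma eq_matchingMatrix_mul (hp : Function.Involutive p) (he : IsTransversal p e) {r : ℕ}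
    {U : Matrix (Fin m) (Fin r) S} (hU : ∀ a, U (p a) = -U a) :
    U = matchingMatrix S p e * U.submatrix e id := by
  have key : ∀ k j, (matchingMatrix S p e * U.submatrix e id) (e k) j = U (e k) j := by
    intro k j
    simp [Matrix.mul_apply, matchingMatrix_apply_transversal he, Matrix.one_apply]
  ext a j
  obtain ⟨k, rfl | rfl⟩ := he.exists_eq a
  · exact (key k j).symm
  · have h1 : U (p (e k)) j = -U (e k) j := congrFun (hU (e k)) j
    rw [h1, ← key]
    simp only [Matrix.mul_apply, matchingMatrix_apply_involution hp he, neg_mul,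
      Finset.sum_neg_distrib]

/-- The summands that omit `a` and `p a` differ only in the opposite factors `ℓ_(p a)` and `ℓ_a`, so
they cancel in pairs, in every characteristic. -/
lemma restrictTo_matchingMatrix {K : Type u} [CommRing K] [Algebra K S] (hm : m ≠ 0)
    (hp : Function.Involutive p) (hne : ∀ a, p a ≠ a) (he : IsTransversal p e) :
    restrictTo (matchingMatrix S p e) (MvPolynomial.esymm (Fin m) K (m - 1)) = 0 := by
  rw [restrictTo_esymm, if_neg hm]
  have hform : ∀ a, rowForm (matchingMatrix S p e) (p a) = -rowForm (matchingMatrix S p e) a := by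
    intro a
    simp [rowForm, matchingMatrix_apply_involution hp he]
  refine Finset.sum_involution (fun a _ => p a) ?_ (fun a _ _ => hne a)
    (fun _ _ => Finset.mem_univ _) (fun a _ => hp a)
  intro a _
  rw [← Finset.mul_prod_erase _ _ (show p a ∈ Finset.univ.erase a by simpa using hne a),
    ← Finset.mul_prod_erase _ _ (show a ∈ Finset.univ.erase (p a) by simpa using (hne a).symm),
    Finset.erase_right_comm, hform]
  ring

end Matching

/-! ### Perfect matchings as involutions without fixed points -/

/-- The perfect matching given by an involution without fixed points. -/
def involutionSubgraph {m : ℕ} (p : Fin m → Fin m) (hp : Function.Involutive p)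
    (hne : ∀ a, p a ≠ a) : (⊤ : SimpleGraph (Fin m)).Subgraph where
  verts := Set.univ
  Adj a b := p a = b
  adj_sub {a b} h := by
    rw [SimpleGraph.top_adj]
    rintro rfl
    exact hne a h
  edge_vert _ := Set.mem_univ _
  symm := ⟨fun a b h => by rw [← h, hp]⟩

lemma involutionSubgraph_isPerfectMatching {m : ℕ} {p : Fin m → Fin m}
    (hp : Function.Involutive p) (hne : ∀ a, p a ≠ a) :
    (involutionSubgraph p hp hne).IsPerfectMatching :=
  ⟨fun a _ => ⟨p a, rfl, fun b h => (show p a = b from h).symm⟩, fun _ => Set.mem_univ _⟩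

lemma exists_involution_of_isPerfectMatching {m : ℕ} {M : (⊤ : SimpleGraph (Fin m)).Subgraph}
    (hM : M.IsPerfectMatching) : ∃ p : Fin m → Fin m, Function.Involutive p ∧ (∀ a, p a ≠ a) ∧
      ∀ a b, M.Adj a b ↔ p a = b := by
  choose p hp hu using fun a => hM.1 (hM.2 a)
  refine ⟨p, fun a => (hu _ _ (hp a).symm).symm, fun a h => ?_,
    fun a b => ⟨fun h => (hu a b h).symm, fun h => h ▸ hp a⟩⟩
  have := hp a
  dsimp only at this
  rw [h] at this
  exact M.loopless.irrefl a this

lemma mem_matchingSpace_iff {K : Type u} [Field K] {m : ℕ}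
    {M : (⊤ : SimpleGraph (Fin m)).Subgraph} {p : Fin m → Fin m}
    (h : ∀ a b, M.Adj a b ↔ p a = b) {v : Fin m → K} :
    v ∈ matchingSpace K M ↔ ∀ a, v (p a) = -v a := by
  change (∀ a b, M.Adj a b → v a + v b = 0) ↔ _
  simp only [h, forall_eq']
  exact forall_congr' fun a => by rw [add_comm, eq_neg_iff_add_eq_zero]

lemma matchingSpace_le_imp_eq {K : Type u} [Field K] {m : ℕ}
    {M N : (⊤ : SimpleGraph (Fin m)).Subgraph} (hM : M.IsPerfectMatching)
    (hN : N.IsPerfectMatching) (h : matchingSpace K M ≤ matchingSpace K N) : M = N := by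
  obtain ⟨p, hp, hpne, hpM⟩ := exists_involution_of_isPerfectMatching hM
  obtain ⟨q, hq, hqne, hqN⟩ := exists_involution_of_isPerfectMatching hN
  have hpq : ∀ a, p a = q a := by
    intro a
    -- This vector is supported on one pair of `M`; the equation of `N` at `a` can hold for it only
    -- if `q a = p a`.
    let v : Fin m → K := Pi.single a 1 - Pi.single (p a) 1
    have hv : v ∈ matchingSpace K M := by
      rw [mem_matchingSpace_iff hpM]
      intro b
      simp only [v, Pi.sub_apply, Pi.single_apply, hp.injective.eq_iff, hp.eq_iff, neg_sub]
    have h1 := (mem_matchingSpace_iff hqN).mp (h hv) a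
    by_contra hne
    simp [v, (hpne a).symm, hqne a, Ne.symm hne] at h1
  refine SimpleGraph.Subgraph.ext ?_ ?_
  · rw [hM.2.verts_eq_univ, hN.2.verts_eq_univ]
  · ext a b
    rw [hpM, hqN, hpq]

lemma cycleType_eq_replicate_iff {n : ℕ} (hn : n ≠ 0) (σ : Equiv.Perm (Fin (2 * n))) :
    σ.cycleType = Multiset.replicate n 2 ↔ Function.Involutive σ ∧ ∀ a, σ a ≠ a := by
  constructor
  · intro h
    have h1 : orderOf σ = 2 := by
      rw [← Equiv.Perm.lcm_cycleType, h]
      refine Nat.dvd_antisymm (Multiset.lcm_dvd.mpr fun b hb => ?_)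
        (Multiset.dvd_lcm (Multiset.mem_replicate.mpr ⟨hn, rfl⟩))
      rw [Multiset.eq_of_mem_replicate hb]
    refine ⟨fun a => ?_, fun a ha => ?_⟩
    · have h2 := pow_orderOf_eq_one σ
      rw [h1, sq] at h2
      exact DFunLike.congr_fun h2 a
    · have h2 := σ.sum_cycleType
      rw [h, Multiset.sum_replicate, smul_eq_mul, mul_comm] at h2
      have h3 : σ.support = Finset.univ := by
        rw [← Finset.card_eq_iff_eq_univ, ← h2, Fintype.card_fin]
      have h4 := Finset.mem_univ a
      rw [← h3, Equiv.Perm.mem_support] at h4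
      exact h4 ha
  · rintro ⟨h1, h2⟩
    have h3 : σ ^ 2 = 1 := by
      ext a
      rw [sq, Equiv.Perm.mul_apply, h1 a]
      rfl
    have h4 : ∀ b ∈ σ.cycleType, b = 2 := fun b hb =>
      le_antisymm (Nat.le_of_dvd two_pos ((Equiv.Perm.dvd_of_mem_cycleType hb).trans
        (orderOf_dvd_of_pow_eq_one h3))) (Equiv.Perm.two_le_of_mem_cycleType hb)
    have h5 : σ.support = Finset.univ := by
      ext a
      simp [h2 a]
    have h6 := σ.sum_cycleType
    rw [Multiset.eq_replicate_of_mem h4] at h6 ⊢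
    rw [h5, Multiset.sum_replicate, Finset.card_univ, Fintype.card_fin, smul_eq_mul] at h6
    congr 1
    lia

lemma doubleFactorial_mul_two_pow_mul_factorial {n : ℕ} (hn : n ≠ 0) :
    Nat.doubleFactorial (2 * n - 1) * (2 ^ n * Nat.factorial n) = Nat.factorial (2 * n) := by
  obtain ⟨k, hk⟩ : ∃ k, 2 * n = k + 1 := ⟨2 * n - 1, by lia⟩
  rw [← Nat.doubleFactorial_two_mul, mul_comm, hk, Nat.add_sub_cancel,
    Nat.factorial_eq_mul_doubleFactorial]

/-- Permutations of cycle type `2^n` form a conjugacy class with centralizer of order `2^n n!`, and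
`(2n)! = (2n-1)!! · 2^n n!`. -/
lemma card_involutions {n : ℕ} (hn : n ≠ 0) :
    {σ : Equiv.Perm (Fin (2 * n)) | Function.Involutive σ ∧ ∀ a, σ a ≠ a}.ncard =
      Nat.doubleFactorial (2 * n - 1) := by
  classical
  have h := Equiv.Perm.card_of_cycleType_mul_eq (α := Fin (2 * n)) (Multiset.replicate n 2)
  have hsum : (Multiset.replicate n 2).sum = 2 * n := by
    rw [Multiset.sum_replicate, smul_eq_mul, mul_comm]
  rw [if_pos ⟨by rw [hsum, Fintype.card_fin], fun a ha => (Multiset.eq_of_mem_replicate ha).ge⟩,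
    hsum, Fintype.card_fin, Nat.sub_self, Nat.factorial_zero, one_mul, Multiset.prod_replicate,
    Multiset.toFinset_replicate, if_neg hn, Finset.prod_singleton, Multiset.count_replicate_self,
    ← doubleFactorial_mul_two_pow_mul_factorial hn] at h
  rw [← Nat.eq_of_mul_eq_mul_right (by positivity) h, ← Set.ncard_coe_finset]
  congr 1
  ext σ
  simp [cycleType_eq_replicate_iff hn]

lemma ncard_isPerfectMatching {n : ℕ} (hn : n ≠ 0) :
    {M : (⊤ : SimpleGraph (Fin (2 * n))).Subgraph | M.IsPerfectMatching}.ncard =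
      Nat.doubleFactorial (2 * n - 1) := by
  rw [← card_involutions hn]
  symm
  refine Set.ncard_congr (fun σ hσ => involutionSubgraph σ hσ.1 hσ.2)
    (fun σ hσ => involutionSubgraph_isPerfectMatching hσ.1 hσ.2) ?_ ?_
  · intro σ τ hσ hτ h
    ext1 a
    have h1 : (involutionSubgraph σ hσ.1 hσ.2).Adj a (σ a) := rfl
    rw [h] at h1
    exact (show τ a = σ a from h1).symm
  · intro M hM
    obtain ⟨p, hp, hne, hpM⟩ := exists_involution_of_isPerfectMatching hM
    refine ⟨hp.toPerm, ⟨hp, hne⟩, SimpleGraph.Subgraph.ext ?_ ?_⟩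
    · rw [hM.2.verts_eq_univ]
      rfl
    · ext a b
      exact (hpM a b).symm

/-! ### Homomorphisms of Plücker algebras -/

section PluckerMap

variable {K S R : Type u} [CommRing K] [CommRing S] [Algebra K S] [CommRing R] [Algebra K R]
  {m m' r : ℕ}

/-- The homomorphism of Plücker algebras induced by `ψ : S → R` if `ψ` sends the maximal minors of
`U` into the Plücker algebra of `V`. -/
def pluckerMap (ψ : S →ₐ[K] R) (U : Matrix (Fin m) (Fin r) S) (V : Matrix (Fin m') (Fin r) R)
    (h : ∀ σ : Fin r → Fin m,
      Polynomial.monomial 1 ((U.map ψ).submatrix σ id).det ∈ pluckerAlgebra K V) :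
    pluckerAlgebra K U →ₐ[K] pluckerAlgebra K V :=
  ((Polynomial.mapAlgHom ψ).comp (pluckerAlgebra K U).val).codRestrict (pluckerAlgebra K V) (by
    intro b
    induction b using pluckerAlgebra_induction with
    | coord σ =>
      have h1 := h σ
      rw [map_submatrix_det] at h1
      change Polynomial.map (ψ : S →+* R) (Polynomial.monomial 1 _) ∈ _
      rwa [Polynomial.map_monomial]
    | algebraMap c =>
      rw [AlgHom.commutes]
      exact Subalgebra.algebraMap_mem _ c
    | add x y hx hy => rw [map_add]; exact add_mem hx hy
    | mul x y hx hy => rw [map_mul]; exact mul_mem hx hy)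

lemma coe_pluckerMap {ψ : S →ₐ[K] R} {U : Matrix (Fin m) (Fin r) S} {V : Matrix (Fin m') (Fin r) R}
    {h : ∀ σ : Fin r → Fin m,
      Polynomial.monomial 1 ((U.map ψ).submatrix σ id).det ∈ pluckerAlgebra K V}
    (b : pluckerAlgebra K U) :
    (pluckerMap ψ U V h b : Polynomial R) = Polynomial.map (ψ : S →+* R) (b : Polynomial S) := rfl

lemma coe_pluckerMap_pluckerCoord {ψ : S →ₐ[K] R} {U : Matrix (Fin m) (Fin r) S}
    {V : Matrix (Fin m') (Fin r) R} {h : ∀ σ : Fin r → Fin m,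
      Polynomial.monomial 1 ((U.map ψ).submatrix σ id).det ∈ pluckerAlgebra K V}
    (σ : Fin r → Fin m) : (pluckerMap ψ U V h (pluckerCoord K U σ) : Polynomial R) =
      Polynomial.monomial 1 ((U.map ψ).submatrix σ id).det := by
  rw [coe_pluckerMap, map_submatrix_det]
  exact Polynomial.map_monomial _

/-- `pluckerMap` as a homomorphism of graded rings. -/
def gradedPluckerMap (ψ : S →ₐ[K] R) (U : Matrix (Fin m) (Fin r) S)
    (V : Matrix (Fin m') (Fin r) R) (h : ∀ σ : Fin r → Fin m,
      Polynomial.monomial 1 ((U.map ψ).submatrix σ id).det ∈ pluckerAlgebra K V) :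
    GradedRingHom (pluckerGrading K U) (pluckerGrading K V) where
  toRingHom := (pluckerMap ψ U V h : pluckerAlgebra K U →+* pluckerAlgebra K V)
  map_mem := by
    rintro d b ⟨a, ha⟩
    refine ⟨ψ a, ?_⟩
    change ((pluckerMap ψ U V h b : pluckerAlgebra K V) : Polynomial R) = _
    rw [coe_pluckerMap, ha, Polynomial.map_monomial]
    rfl

lemma gradedPluckerMap_surjective {ψ : S →ₐ[K] R} {U : Matrix (Fin m) (Fin r) S}
    {V : Matrix (Fin m') (Fin r) R} {h : ∀ σ : Fin r → Fin m,
      Polynomial.monomial 1 ((U.map ψ).submatrix σ id).det ∈ pluckerAlgebra K V}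
    (hs : ∀ τ : Fin r → Fin m', ∃ σ, ((U.map ψ).submatrix σ id).det = (V.submatrix τ id).det) :
    Function.Surjective (gradedPluckerMap ψ U V h) := by
  suffices hsurj : Function.Surjective (pluckerMap ψ U V h) from hsurj
  intro b
  rw [← AlgHom.mem_range]
  induction b using pluckerAlgebra_induction with
  | coord τ =>
    obtain ⟨σ, hσ⟩ := hs τ
    refine ⟨pluckerCoord K U σ, Subtype.ext ?_⟩
    refine (coe_pluckerMap_pluckerCoord (h := h) σ).trans ?_
    rw [hσ]
    rfl
  | algebraMap c => exact Subalgebra.algebraMap_mem _ c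
  | add x y hx hy => exact add_mem hx hy
  | mul x y hx hy => exact mul_mem hx hy

end PluckerMap

/-! ### Matrices with vanishing rows -/

/-- The matrix with the rows of `U` in the positions `ι` and with all other rows zero. -/
def extendRows {S : Type u} [CommRing S] {m m' r : ℕ} (ι : Fin m' → Fin m)
    (U : Matrix (Fin m') (Fin r) S) : Matrix (Fin m) (Fin r) S :=
  Matrix.of fun k c => Function.extend ι (fun a => U a c) 0 k

section ExtendRows

variable {S R : Type u} [CommRing S] [CommRing R] {m m' r : ℕ} {ι : Fin m' → Fin m}

lemma extendRows_apply (hι : Function.Injective ι) (U : Matrix (Fin m') (Fin r) S) (a : Fin m')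
    (c : Fin r) : extendRows ι U (ι a) c = U a c :=
  hι.extend_apply (fun a => U a c) 0 a

lemma extendRows_of_notMem (U : Matrix (Fin m') (Fin r) S) {k : Fin m} (hk : k ∉ Set.range ι) :
    extendRows ι U k = 0 :=
  funext fun c => Function.extend_apply' (fun a => U a c) (0 : Fin m → S) k hk

lemma extendRows_submatrix_det (hι : Function.Injective ι) (U : Matrix (Fin m') (Fin r) S)
    (τ : Fin r → Fin m') :
    ((extendRows ι U).submatrix (ι ∘ τ) id).det = (U.submatrix τ id).det := by
  congr 1
  ext a c
  exact extendRows_apply hι U _ _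

lemma extendRows_submatrix_det_eq_zero (U : Matrix (Fin m') (Fin r) S) {σ : Fin r → Fin m}
    {c : Fin r} (hc : σ c ∉ Set.range ι) : ((extendRows ι U).submatrix σ id).det = 0 :=
  Matrix.det_eq_zero_of_row_eq_zero c fun d => congrFun (extendRows_of_notMem U hc) d

lemma extendRows_map (hι : Function.Injective ι) (φ : S →+* R) (U : Matrix (Fin m') (Fin r) S) :
    (extendRows ι U).map φ = extendRows ι (U.map φ) := by
  ext k c
  by_cases hk : k ∈ Set.range ι
  · obtain ⟨a, rfl⟩ := hk
    rw [Matrix.map_apply, extendRows_apply hι, extendRows_apply hι, Matrix.map_apply]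
  · have h1 : extendRows ι U k c = 0 := congrFun (extendRows_of_notMem U hk) c
    have h2 : extendRows ι (U.map φ) k c = 0 := congrFun (extendRows_of_notMem _ hk) c
    rw [Matrix.map_apply, h1, h2, map_zero]

lemma extendRows_submatrix (hι : Function.Injective ι) {U : Matrix (Fin m) (Fin r) S}
    (hU : ∀ k ∉ Set.range ι, U k = 0) : extendRows ι (U.submatrix ι id) = U := by
  ext k c
  by_cases hk : k ∈ Set.range ι
  · obtain ⟨a, rfl⟩ := hk
    exact extendRows_apply hι _ _ _
  · exact (congrFun (extendRows_of_notMem _ hk) c).trans (congrFun (hU k hk) c).symm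

/-- A minor that selects an inserted zero row vanishes; every other one is a minor of `U`. -/
lemma monomial_extendRows_mem {K : Type u} [CommRing K] [Algebra K S] (hι : Function.Injective ι)
    (U : Matrix (Fin m') (Fin r) S) (σ : Fin r → Fin m) :
    Polynomial.monomial 1 ((extendRows ι U).submatrix σ id).det ∈ pluckerAlgebra K U := by
  by_cases h : ∀ c, σ c ∈ Set.range ι
  · choose τ hτ using h
    obtain rfl : ι ∘ τ = σ := funext hτ
    rw [extendRows_submatrix_det hι]
    exact Algebra.subset_adjoin ⟨τ, rfl⟩
  · push Not at h
    obtain ⟨c, hc⟩ := h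
    rw [extendRows_submatrix_det_eq_zero U hc, map_zero]
    exact zero_mem _

/-- A product that omits only one coordinate still contains `x_i` or `x_j`. -/
lemma restrictTo_esymm_eq_zero_of_rows {K : Type u} [CommRing K] [Algebra K S]
    {U : Matrix (Fin m) (Fin r) S} {i j : Fin m} (hij : i ≠ j) (hi : U i = 0) (hj : U j = 0) :
    restrictTo U (MvPolynomial.esymm (Fin m) K (m - 1)) = 0 := by
  rw [restrictTo_esymm, if_neg (by have := i.2; lia)]
  refine Finset.sum_eq_zero fun k _ => ?_
  by_cases hk : k = i
  · exact Finset.prod_eq_zero (i := j) (by simp [hk, hij.symm]) (rowForm_eq_zero_iff.mpr hj)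
  · exact Finset.prod_eq_zero (i := i) (by simpa using Ne.symm hk) (rowForm_eq_zero_iff.mpr hi)

end ExtendRows

lemma det_submatrix_mvPolynomialX_ne_zero {R : Type u} [CommRing R] [Nontrivial R] {m r : ℕ}
    {σ : Fin r → Fin m} (hσ : Function.Injective σ) :
    ((Matrix.mvPolynomialX (Fin m) (Fin r) R).submatrix σ id).det ≠ 0 := by
  intro h
  have h1 := map_submatrix_det (MvPolynomial.eval fun p : Fin m × Fin r =>
    if p.1 = σ p.2 then (1 : R) else 0) (Matrix.mvPolynomialX (Fin m) (Fin r) R) σ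
  have h2 : ((Matrix.mvPolynomialX (Fin m) (Fin r) R).map (MvPolynomial.eval fun p : Fin m × Fin r =>
    if p.1 = σ p.2 then (1 : R) else 0)).submatrix σ id = 1 := by
    ext a b
    simp [hσ.eq_iff, Matrix.one_apply]
  rw [h, map_zero, h2, Matrix.det_one] at h1
  exact one_ne_zero h1

/-- Evaluation of `FanoRing` at a matrix over a `K`-algebra whose column space lies in `f = 0`. -/
lemma exists_algHom_fanoMatrix_map {K : Type u} [Field K] {m r : ℕ} {f : MvPolynomial (Fin m) K}
    {S : Type u} [CommRing S] [Algebra K S] (U : Matrix (Fin m) (Fin r) S)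
    (hf : restrictTo U f = 0) : ∃ ψ : FanoRing r f →ₐ[K] S, (fanoMatrix r f).map ψ = U := by
  let ev : MvPolynomial (Fin m × Fin r) K →ₐ[K] S :=
    MvPolynomial.aeval fun p : Fin m × Fin r => U p.1 p.2
  have hev : (Matrix.mvPolynomialX (Fin m) (Fin r) K).map ev = U := by
    ext i j
    simp [ev]
  refine ⟨Ideal.Quotient.liftₐ (fanoIdeal r f) ev fun a ha => ?_, ?_⟩
  · have hle : fanoIdeal r f ≤ RingHom.ker ev := by
      refine Ideal.span_le.mpr ?_
      rintro _ ⟨d, rfl⟩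
      have h := map_restrictTo ev (Matrix.mvPolynomialX (Fin m) (Fin r) K) f
      rw [hev, hf] at h
      have h' := congrArg (MvPolynomial.coeff d) h
      rw [MvPolynomial.coeff_map, MvPolynomial.coeff_zero] at h'
      exact h'
    exact hle ha
  · exact Eq.trans rfl hev

lemma evalPlucker_congr {K : Type u} [Field K] {m r : ℕ} {f : MvPolynomial (Fin m) K} {L : Type u}
    [Field L] [Algebra K L] {U V : Matrix (Fin m) (Fin r) L} (h : U = V) (hU : restrictTo U f = 0)
    (hV : restrictTo V f = 0) (b : pluckerAlgebra K (fanoMatrix r f)) :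
    evalPlucker U hU b = evalPlucker V hV b := by
  subst h
  rfl

/-! ### The components of planes in coordinate subspaces -/

lemma exists_injective_range_eq {m : ℕ} {i j : Fin m} (hij : i ≠ j) :
    ∃ ι : Fin (m - 2) → Fin m, Function.Injective ι ∧
      ∀ k, k ∉ Set.range ι ↔ k = i ∨ k = j := by
  have hcard : (({i, j} : Finset (Fin m))ᶜ).card = m - 2 := by
    rw [Finset.card_compl, Finset.card_pair hij, Fintype.card_fin]
  let e := (Finset.equivFinOfCardEq hcard).symm
  refine ⟨fun a => e a, fun a b hab => e.injective (Subtype.ext hab), fun k => ?_⟩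
  rw [← not_iff_not, not_not]
  constructor
  · rintro ⟨a, rfl⟩
    have := (e a).2
    simpa using this
  · intro hk
    exact ⟨e.symm ⟨k, by simpa using hk⟩, by simp⟩

section Planes

variable {K : Type u} [Field K] {n : ℕ}

/-- The defining condition allows another field and another matrix for the same point, but the
vanishing of a row can be read off from the ideal of the point by `row_eq_zero_iff`. -/
lemma matrixPoint_mem_planesInCoordinateSubspace_iff {L : Type u} [Field L] [Algebra K L]
    {U : Matrix (Fin (2 * n)) (Fin n) L} {hU : LinearIndependent L U.col}
    {hf : restrictTo U (MvPolynomial.esymm (Fin (2 * n)) K (2 * n - 1)) = 0} {i j : Fin (2 * n)} :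
    matrixPoint U hU hf ∈ planesInCoordinateSubspace K n i j ↔ U i = 0 ∧ U j = 0 := by
  constructor
  · rintro ⟨L', _, _, W, ⟨V, hV, hf', rfl, hx⟩, hW⟩
    have hrow : ∀ k, V k = 0 → U k = 0 := by
      intro k hk
      have h := (row_eq_zero_iff (hU := hV) (hf := hf')).mp hk
      rw [← hx] at h
      exact (row_eq_zero_iff (hU := hU) (hf := hf)).mpr h
    have hcol := fun c => hW _ (Submodule.subset_span ⟨c, rfl⟩)
    exact ⟨hrow i (funext fun c => (hcol c).1), hrow j (funext fun c => (hcol c).2)⟩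
  · rintro ⟨hi, hj⟩
    refine ⟨L, inferInstance, inferInstance, _, ⟨U, hU, hf, rfl, rfl⟩, fun v hv => ?_⟩
    induction hv using Submodule.span_induction with
    | mem x hx =>
      obtain ⟨c, rfl⟩ := hx
      exact ⟨congrFun hi c, congrFun hj c⟩
    | zero => simp
    | add x y _ _ hx hy => simp [hx.1, hx.2, hy.1, hy.2]
    | smul a x _ hx => simp [hx.1, hx.2]

/-- The planes in a coordinate subspace of codimension two form the image of a closed immersion of
the Grassmannian. -/
lemma exists_gradedRingHom_planesInCoordinateSubspace {i j : Fin (2 * n)} (hij : i ≠ j) :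
    ∃ g : GradedRingHom (pluckerGrading K
        (fanoMatrix n (MvPolynomial.esymm (Fin (2 * n)) K (2 * n - 1))))
        (pluckerGrading K (Matrix.mvPolynomialX (Fin (2 * n - 2)) (Fin n) K)),
      Function.Surjective g ∧ (∀ c : K, g (algebraMap K _ c) = algebraMap K _ c) ∧
      (∀ x : esymmFano K n, x ∈ planesInCoordinateSubspace K n i j ↔
        ∀ a, g a = 0 → a ∈ x.asHomogeneousIdeal) ∧
      (2 ≤ n → ∃ x : esymmFano K n, (∀ a, g a = 0 ↔ a ∈ x.asHomogeneousIdeal) ∧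
        ∀ k l, x ∈ planesInCoordinateSubspace K n k l → (k = i ∨ k = j) ∧ (l = i ∨ l = j)) := by
  obtain ⟨ι, hι, hrange⟩ := exists_injective_range_eq hij
  let X := Matrix.mvPolynomialX (Fin (2 * n - 2)) (Fin n) K
  have hVf : ∀ {S : Type u} [CommRing S] [Algebra K S] (V : Matrix (Fin (2 * n - 2)) (Fin n) S),
      restrictTo (extendRows ι V) (MvPolynomial.esymm (Fin (2 * n)) K (2 * n - 1)) = 0 :=
    fun V => restrictTo_esymm_eq_zero_of_rows hij
      (extendRows_of_notMem V ((hrange i).mpr (Or.inl rfl)))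
      (extendRows_of_notMem V ((hrange j).mpr (Or.inr rfl)))
  -- The generic matrix with two zero rows inserted satisfies the Fano equations, so the universal
  -- matrix specialises to it.
  obtain ⟨ψ, hψ⟩ := exists_algHom_fanoMatrix_map (extendRows ι X) (hVf X)
  have hmem : ∀ σ, Polynomial.monomial 1
      (((fanoMatrix n (MvPolynomial.esymm (Fin (2 * n)) K (2 * n - 1))).map ψ).submatrix σ id).det ∈
        pluckerAlgebra K X := by
    intro σ
    rw [hψ]
    exact monomial_extendRows_mem hι X σ
  let g := gradedPluckerMap ψ (fanoMatrix n (MvPolynomial.esymm (Fin (2 * n)) K (2 * n - 1))) X hmem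
  -- Evaluation at a specialisation of the extended generic matrix factors through `g`, so it kills
  -- the kernel of `g`.
  have heval : ∀ {L : Type u} [Field L] [Algebra K L]
      (φ : MvPolynomial (Fin (2 * n - 2) × Fin n) K →ₐ[K] L) (b),
      evalPlucker (extendRows ι (X.map φ)) (hVf (X.map φ)) b =
        Polynomial.map (φ : MvPolynomial (Fin (2 * n - 2) × Fin n) K →+* L)
          ((pluckerAlgebra K X).val (g b)) := by
    intro L _ _ φ b
    have key : evalPlucker (extendRows ι (X.map φ)) (hVf (X.map φ)) =
        ((Polynomial.mapAlgHom φ).comp (pluckerAlgebra K X).val).comp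
          (pluckerMap ψ (fanoMatrix n _) X hmem) := by
      refine pluckerAlgebra_algHom_ext fun σ => ?_
      rw [evalPlucker_pluckerCoord, AlgHom.comp_apply, AlgHom.comp_apply, Subalgebra.coe_val,
        coe_pluckerMap_pluckerCoord, hψ]
      have h1 := extendRows_map hι (φ : MvPolynomial (Fin (2 * n - 2) × Fin n) K →+* L) X
      have h2 := map_submatrix_det (φ : MvPolynomial (Fin (2 * n - 2) × Fin n) K →+* L) (extendRows ι X) σ
      rw [h1] at h2
      exact (congrArg _ h2).trans (Polynomial.map_monomial (φ : MvPolynomial (Fin (2 * n - 2) × Fin n) K →+* L)).symm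
    exact DFunLike.congr_fun key b
  have hcoord : ∀ k ∉ Set.range ι, ∀ τ : Fin n → Fin (2 * n), k ∈ Set.range τ →
      g (pluckerCoord K _ τ) = 0 := by
    rintro k hk τ ⟨c, rfl⟩
    apply Subtype.ext
    refine (coe_pluckerMap_pluckerCoord (h := hmem) τ).trans ?_
    rw [hψ, extendRows_submatrix_det_eq_zero X hk, map_zero]
    rfl
  refine ⟨g, gradedPluckerMap_surjective fun τ => ⟨ι ∘ τ, ?_⟩, fun c => ?_, fun x => ?_,
    fun hn => ?_⟩
  · rw [hψ, extendRows_submatrix_det hι]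
  · exact (pluckerMap ψ _ X hmem).commutes c
  · obtain ⟨L, _, _, U, hU, hf, rfl⟩ := exists_matrixPoint x
    constructor
    · intro hx a ha
      rw [matrixPoint_mem_planesInCoordinateSubspace_iff] at hx
      let φ : MvPolynomial (Fin (2 * n - 2) × Fin n) K →ₐ[K] L :=
        MvPolynomial.aeval fun p => U (ι p.1) p.2
      have hφ : X.map φ = U.submatrix ι id := by
        ext a c
        simp [X, φ]
      have hUφ : extendRows ι (X.map φ) = U := by
        rw [hφ]
        refine extendRows_submatrix hι fun k hk => ?_
        rcases (hrange k).mp hk with rfl | rfl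
        exacts [hx.1, hx.2]
      have h1 := heval φ a
      rw [ha] at h1
      rw [mem_matrixPoint]
      have h2 : evalPlucker U hf a =
          evalPlucker (extendRows ι (X.map φ)) (hVf (X.map φ)) a :=
        evalPlucker_congr hUφ.symm _ _ _
      rw [h2, h1]
      exact Polynomial.map_zero _
    · intro h
      rw [matrixPoint_mem_planesInCoordinateSubspace_iff]
      exact ⟨row_eq_zero_iff.mpr fun τ hτ => h _ (hcoord i ((hrange i).mpr (Or.inl rfl)) τ hτ),
        row_eq_zero_iff.mpr fun τ hτ => h _ (hcoord j ((hrange j).mpr (Or.inr rfl)) τ hτ)⟩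
  -- The generic point: `L` is the fraction field of the polynomial ring, and the nonzero rows
  -- consist of independent indeterminates. Since `φ` is injective, the ideal of this point is
  -- exactly the kernel of `g`.
  · obtain ⟨L, _, _, φ, hker⟩ := exists_algHom_field_ker (K := K)
      (⊥ : Ideal (MvPolynomial (Fin (2 * n - 2) × Fin n) K))
    have hφ : Function.Injective φ := (injective_iff_map_eq_zero φ).mpr fun a ha => (hker a).mp ha
    -- This is where `2 ≤ n` is needed: `2n - 2` rows must leave room for a nonzero minor of size
    -- `n`.
    have hle : n ≤ 2 * n - 2 := by lia
    have hdet : ((extendRows ι (X.map φ)).submatrix (ι ∘ Fin.castLE hle) id).det ≠ 0 := by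
      rw [extendRows_submatrix_det hι, map_submatrix_det]
      exact (map_ne_zero_iff φ hφ).mpr (det_submatrix_mvPolynomialX_ne_zero (Fin.castLE_injective hle))
    have hLI : LinearIndependent L (extendRows ι (X.map φ)).col :=
      linearIndependent_col_of_minor_ne_zero _ hdet
    refine ⟨matrixPoint (extendRows ι (X.map φ)) hLI (hVf _), fun a => ?_, fun k l hkl => ?_⟩
    · rw [mem_matrixPoint, heval]
      exact Subtype.ext_iff.trans (Polynomial.map_eq_zero_iff
        (f := (φ : MvPolynomial (Fin (2 * n - 2) × Fin n) K →+* L)) hφ).symm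
    · rw [matrixPoint_mem_planesInCoordinateSubspace_iff] at hkl
      have hzero : ∀ k, extendRows ι (X.map φ) k = 0 → k = i ∨ k = j := by
        intro k hk
        rw [← hrange]
        rintro ⟨a, rfl⟩
        have h1 : φ (X a ⟨0, by lia⟩) = 0 :=
          (extendRows_apply hι (X.map φ) a ⟨0, by lia⟩).symm.trans (congrFun hk _)
        rw [map_eq_zero_iff φ hφ] at h1
        exact MvPolynomial.X_ne_zero _ h1
      exact ⟨hzero k hkl.1, hzero l hkl.2⟩

end Planes

/-! ### Isolated points, components and their number -/

section Main

variable {K : Type u} [Field K] {n : ℕ}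

lemma linearIndependent_matchingMatrix_col {m : ℕ} {p : Fin m → Fin m} {e : Fin n → Fin m}
    (he : IsTransversal p e) : LinearIndependent K (matchingMatrix K p e).col :=
  linearIndependent_col_of_minor_ne_zero _ (σ := e) (by
    rw [matchingMatrix_submatrix he, Matrix.det_one]
    exact one_ne_zero)

lemma span_matchingMatrix {m : ℕ} {M : (⊤ : SimpleGraph (Fin m)).Subgraph} {p : Fin m → Fin m}
    (hp : Function.Involutive p) (hpM : ∀ a b, M.Adj a b ↔ p a = b) {e : Fin n → Fin m}
    (he : IsTransversal p e) :
    Submodule.span K (Set.range (matchingMatrix K p e).col) = matchingSpace K M := by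
  refine le_antisymm (Submodule.span_le.mpr ?_) fun v hv => ?_
  · rintro _ ⟨j, rfl⟩
    exact (mem_matchingSpace_iff hpM).mpr fun a => matchingMatrix_apply_involution hp he a j
  · rw [mem_matchingSpace_iff hpM] at hv
    have h := eq_matchingMatrix_mul (S := K) hp he
      (U := Matrix.of fun a (_ : Fin 1) => v a) fun a => funext fun _ => hv a
    have hv' : v = ∑ j, v (e j) • (matchingMatrix K p e).col j := by
      funext a
      have h1 := congrFun (congrFun h a) 0
      simp only [Matrix.of_apply, Matrix.mul_apply, Matrix.submatrix_apply] at h1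
      simp [h1, Matrix.col, mul_comm]
    rw [hv']
    exact sum_mem fun j _ => Submodule.smul_mem _ _ (Submodule.subset_span ⟨j, rfl⟩)

/-- Any basis of the matching space is the standard matrix times a square matrix, so all bases
define the same point. -/
lemma isPointOf_matchingSpace_iff {m : ℕ} {f : MvPolynomial (Fin m) K}
    {M : (⊤ : SimpleGraph (Fin m)).Subgraph} {p : Fin m → Fin m}
    (hp : Function.Involutive p) (hpM : ∀ a b, M.Adj a b ↔ p a = b) {e : Fin n → Fin m}
    (he : IsTransversal p e) (hf : restrictTo (matchingMatrix K p e) f = 0) {x : fanoScheme n f} :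
    IsPointOf x (matchingSpace K M) ↔
      x = matrixPoint (matchingMatrix K p e) (linearIndependent_matchingMatrix_col he) hf := by
  constructor
  · rintro ⟨V, hV, hf', hVspan, rfl⟩
    refine matrixPoint_eq_of_eq_mul (AlgHom.id K K) (G := V.submatrix e id) ?_
    refine eq_matchingMatrix_mul hp he fun a => funext fun j => ?_
    have hj : V.col j ∈ matchingSpace K M := by
      rw [← hVspan]
      exact Submodule.subset_span ⟨j, rfl⟩
    exact (mem_matchingSpace_iff hpM).mp hj a
  · rintro rfl
    exact ⟨_, _, hf, span_matchingMatrix hp hpM he, rfl⟩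

lemma existsUnique_isPointOf_matchingSpace (hn : n ≠ 0)
    {M : (⊤ : SimpleGraph (Fin (2 * n))).Subgraph} (hM : M.IsPerfectMatching) :
    ∃! x : esymmFano K n, IsPointOf x (matchingSpace K M) := by
  obtain ⟨p, hp, hne, hpM⟩ := exists_involution_of_isPerfectMatching hM
  obtain ⟨e, he⟩ := exists_isTransversal hp hne
  have hf := restrictTo_matchingMatrix (K := K) (S := K) (m := 2 * n) (by lia) hp hne he
  exact ⟨_, (isPointOf_matchingSpace_iff hp hpM he hf).mpr rfl,
    fun y hy => (isPointOf_matchingSpace_iff hp hpM he hf).mp hy⟩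

lemma isClosed_of_isPointOf {m : ℕ} {f : MvPolynomial (Fin m) K} {x : fanoScheme n f}
    {W : Submodule K (Fin m → K)} (hx : IsPointOf x W) : IsClosed {x} := by
  obtain ⟨U, hU, hf, -, rfl⟩ := hx
  exact isClosed_matrixPoint

lemma isPointOf_unique {m : ℕ} {f : MvPolynomial (Fin m) K} {x : fanoScheme n f}
    {W W' : Submodule K (Fin m → K)} (hx : IsPointOf x W) (hx' : IsPointOf x W') : W = W' := by
  obtain ⟨U, hU, hf, rfl, rfl⟩ := hx
  obtain ⟨V, hV, hf', rfl, h⟩ := hx'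
  exact le_antisymm (span_le_of_matrixPoint_eq h.symm) (span_le_of_matrixPoint_eq h)

variable (K n) in
/-- The points of the Fano scheme that are given by perfect matchings. -/
def matchingPoints : Set (esymmFano K n) :=
  {x | ∃ M : (⊤ : SimpleGraph (Fin (2 * n))).Subgraph, M.IsPerfectMatching ∧
    IsPointOf x (matchingSpace K M)}

lemma ncard_matchingPoints (hn : n ≠ 0) :
    (matchingPoints K n).ncard = Nat.doubleFactorial (2 * n - 1) := by
  rw [← ncard_isPerfectMatching hn]
  symm
  refine Set.ncard_congr (fun M hM => (existsUnique_isPointOf_matchingSpace (K := K) hn hM).choose)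
    (fun M hM => ⟨M, hM, (existsUnique_isPointOf_matchingSpace hn hM).choose_spec.1⟩) ?_ ?_
  · intro M N hM hN h
    have hx := (existsUnique_isPointOf_matchingSpace (K := K) hn hM).choose_spec.1
    have hy := (existsUnique_isPointOf_matchingSpace (K := K) hn hN).choose_spec.1
    dsimp only at h hx hy
    rw [← h] at hy
    exact matchingSpace_le_imp_eq hM hN (isPointOf_unique hx hy).le
  · rintro x ⟨M, hM, hx⟩
    exact ⟨M, hM, ((existsUnique_isPointOf_matchingSpace hn hM).choose_spec.2 x hx).symm⟩

lemma finite_matchingPoints (hn : n ≠ 0) : (matchingPoints K n).Finite :=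
  Set.finite_of_ncard_ne_zero (by
    rw [ncard_matchingPoints hn]
    exact (Nat.doubleFactorial_pos _).ne')

lemma isClosed_of_mem_matchingPoints {x : esymmFano K n} (hx : x ∈ matchingPoints K n) :
    IsClosed {x} := by
  obtain ⟨M, -, hx⟩ := hx
  exact isClosed_of_isPointOf hx

/-- The matching space contains the vector `e_i - e_(p i)`, whose `i`-th coordinate is not zero. -/
lemma notMem_planes_of_mem_matchingPoints {x : esymmFano K n} (hx : x ∈ matchingPoints K n)
    (i j : Fin (2 * n)) : x ∉ planesInCoordinateSubspace K n i j := by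
  obtain ⟨M, hM, U, hU, hf, hspan, rfl⟩ := hx
  rw [matrixPoint_mem_planesInCoordinateSubspace_iff]
  rintro ⟨hi, -⟩
  obtain ⟨p, hp, hne, hpM⟩ := exists_involution_of_isPerfectMatching hM
  have hv : (Pi.single i 1 - Pi.single (p i) 1 : Fin (2 * n) → K) ∈ matchingSpace K M := by
    rw [mem_matchingSpace_iff hpM]
    intro b
    simp only [Pi.sub_apply, Pi.single_apply, hp.injective.eq_iff, hp.eq_iff, neg_sub]
  have hle : matchingSpace K M ≤ LinearMap.ker (LinearMap.proj (R := K) (φ := fun _ => K) i) := by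
    rw [← hspan, Submodule.span_le]
    rintro _ ⟨c, rfl⟩
    exact congrFun hi c
  have h1 := hle hv
  simp [(hne i).symm] at h1

/-- Every point of the Fano scheme is given by a perfect matching or lies in a coordinate subspace
of codimension two. -/
lemma isPointOf_matchingSpace_or_mem_planes (hn : n ≠ 0) (x : esymmFano K n) :
    x ∈ matchingPoints K n ∨
    ∃ i j : Fin (2 * n), i < j ∧ x ∈ planesInCoordinateSubspace K n i j := by
  obtain ⟨L, _, _, U, hU, hf, rfl⟩ := exists_matrixPoint x
  have h := hf
  rw [restrictTo_esymm, if_neg (by lia)] at h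
  by_cases h0 : ∃ i, U i = 0
  · right
    obtain ⟨i, hi⟩ := h0
    obtain ⟨j, hji, hj⟩ := exists_ne_row_eq_zero hi h
    rcases lt_or_gt_of_ne hji with hlt | hlt
    · exact ⟨j, i, hlt, matrixPoint_mem_planesInCoordinateSubspace_iff.mpr ⟨hj, hi⟩⟩
    · exact ⟨i, j, hlt, matrixPoint_mem_planesInCoordinateSubspace_iff.mpr ⟨hi, hj⟩⟩
  · left
    push Not at h0
    obtain ⟨p, hp, hne, hpU⟩ := exists_involution_of_row_ne_zero hU h0 h
    have hM := involutionSubgraph_isPerfectMatching hp hne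
    obtain ⟨e, he⟩ := exists_isTransversal hp hne
    have hf0 := restrictTo_matchingMatrix (K := K) (S := K) (m := 2 * n) (by lia) hp hne he
    refine ⟨_, hM, (isPointOf_matchingSpace_iff hp (fun _ _ => Iff.rfl) he hf0).mpr ?_⟩
    -- The plane is defined over `L`, but its matching has a standard matrix over `K`; over `L` the
    -- two differ by a square factor, so the point is the rational one.
    refine matrixPoint_eq_of_eq_mul (Algebra.ofId K L) (G := U.submatrix e id) ?_
    have hmap : (matchingMatrix K p e).map (Algebra.ofId K L) = matchingMatrix L p e := by
      ext a j
      simp only [matchingMatrix, Matrix.map_apply, Matrix.of_apply]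
      split_ifs <;> simp
    rw [hmap]
    exact eq_matchingMatrix_mul hp he hpU

/-- The ideal of the generic point is the kernel of `g`, and a point is in its closure exactly if
its ideal contains this kernel. Closedness and irreducibility of the set follow at once. -/
lemma exists_planes_eq_closure (hn : 2 ≤ n) {i j : Fin (2 * n)} (hij : i ≠ j) :
    ∃ x : esymmFano K n, planesInCoordinateSubspace K n i j = closure {x} ∧
      ∀ k l, x ∈ planesInCoordinateSubspace K n k l → (k = i ∨ k = j) ∧ (l = i ∨ l = j) := by
  obtain ⟨g, -, -, hmem, hgen⟩ := exists_gradedRingHom_planesInCoordinateSubspace (K := K) hij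
  obtain ⟨x, hx, hkl⟩ := hgen hn
  refine ⟨x, ?_, hkl⟩
  ext y
  rw [hmem, ← le_iff_specializes]
  exact forall_congr' fun a => by rw [hx]

lemma planes_subset_iff (hn : 2 ≤ n) {i j k l : Fin (2 * n)} (hij : i < j) (hkl : k < l)
    (h : planesInCoordinateSubspace K n i j ⊆ planesInCoordinateSubspace K n k l) :
    i = k ∧ j = l := by
  obtain ⟨x, hx, hx'⟩ := exists_planes_eq_closure (K := K) hn hij.ne
  have hmem : x ∈ planesInCoordinateSubspace K n i j := by
    rw [hx]
    exact subset_closure rfl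
  obtain ⟨rfl | rfl, rfl | rfl⟩ := hx' k l (h hmem)
  · exact absurd hkl (lt_irrefl _)
  · exact ⟨rfl, rfl⟩
  · exact absurd hkl (lt_asymm hij)
  · exact absurd hkl (lt_irrefl _)

lemma isClosed_planes (hn : 2 ≤ n) {i j : Fin (2 * n)} (hij : i < j) :
    IsClosed (planesInCoordinateSubspace K n i j) := by
  obtain ⟨x, hx, -⟩ := exists_planes_eq_closure (K := K) hn hij.ne
  rw [hx]
  exact isClosed_closure

/-- The complement is a finite union of closed sets: the other matching points and all the
coordinate sets. -/
lemma isOpen_of_mem_matchingPoints (hn : 2 ≤ n) {x : esymmFano K n}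
    (hx : x ∈ matchingPoints K n) : IsOpen {x} := by
  have h : ({x} : Set (esymmFano K n))ᶜ = (⋃ y ∈ matchingPoints K n \ {x}, {y}) ∪
      ⋃ q ∈ {q : Fin (2 * n) × Fin (2 * n) | q.1 < q.2},
        planesInCoordinateSubspace K n q.1 q.2 := by
    ext y
    simp only [Set.mem_compl_iff, Set.mem_singleton_iff, Set.mem_union, Set.mem_iUnion,
      Set.mem_sdiff, exists_prop, Set.mem_ofPred_eq, Prod.exists]
    constructor
    · intro hy
      rcases isPointOf_matchingSpace_or_mem_planes (by lia) y with h1 | ⟨i, j, hij, h1⟩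
      · exact Or.inl ⟨y, ⟨h1, hy⟩, rfl⟩
      · exact Or.inr ⟨i, j, hij, h1⟩
    · rintro (⟨z, ⟨-, hz⟩, rfl⟩ | ⟨i, j, hij, h1⟩)
      · exact hz
      · rintro rfl
        exact notMem_planes_of_mem_matchingPoints hx i j h1
  rw [← isClosed_compl_iff, h]
  refine IsClosed.union ?_ ?_
  · exact ((finite_matchingPoints (by lia)).subset Set.sdiff_subset).isClosed_biUnion
      fun y hy => isClosed_of_mem_matchingPoints hy.1
  · exact (Set.toFinite _).isClosed_biUnion fun q hq => isClosed_planes hn hq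

lemma planes_mem_irreducibleComponents (hn : 2 ≤ n) {i j : Fin (2 * n)} (hij : i < j) :
    planesInCoordinateSubspace K n i j ∈ irreducibleComponents (esymmFano K n) := by
  obtain ⟨x, hx, -⟩ := exists_planes_eq_closure (K := K) hn hij.ne
  have hmem : x ∈ planesInCoordinateSubspace K n i j := by
    rw [hx]
    exact subset_closure rfl
  refine ⟨by rw [hx]; exact isIrreducible_singleton.closure, fun C hC hle => ?_⟩
  have hfin : ((fun y : esymmFano K n => ({y} : Set (esymmFano K n))) '' matchingPoints K n ∪
      (fun q : Fin (2 * n) × Fin (2 * n) => planesInCoordinateSubspace K n q.1 q.2) ''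
        {q | q.1 < q.2}).Finite :=
    ((finite_matchingPoints (by lia)).image _).union ((Set.toFinite _).image _)
  -- The irreducible set `C` lies in one member of the finite closed cover. A single matching point
  -- cannot contain the generic point of `Z_ij`, so this member is some `Z_kl`, and
  -- `planes_subset_iff` identifies it with `Z_ij`.
  obtain ⟨z, hz, hCz⟩ := isIrreducible_iff_sUnion_isClosed.mp hC hfin.toFinset
    (by
      intro z hz
      rw [Set.Finite.mem_toFinset] at hz
      rcases hz with ⟨y, hy, rfl⟩ | ⟨q, hq, rfl⟩
      · exact isClosed_of_mem_matchingPoints hy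
      · exact isClosed_planes hn hq)
    (by
      intro y _
      rw [Set.Finite.coe_toFinset]
      rcases isPointOf_matchingSpace_or_mem_planes (by lia) y with h1 | ⟨k, l, hkl, h1⟩
      · exact ⟨{y}, Or.inl ⟨y, h1, rfl⟩, rfl⟩
      · exact ⟨_, Or.inr ⟨(k, l), hkl, rfl⟩, h1⟩)
  rw [Set.Finite.mem_toFinset] at hz
  rcases hz with ⟨y, hy, rfl⟩ | ⟨⟨k, l⟩, hkl, rfl⟩
  · obtain rfl : x = y := hCz (hle hmem)
    exact absurd hmem (notMem_planes_of_mem_matchingPoints hy i j)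
  · obtain ⟨rfl, rfl⟩ := planes_subset_iff hn hij hkl (Set.Subset.trans hle hCz)
    exact hCz

lemma nonempty_reducedClosed_planes_iso {i j : Fin (2 * n)} (hij : i ≠ j)
    (hc : IsClosed (planesInCoordinateSubspace K n i j)) :
    Nonempty (reducedClosed
      (fanoSchemeToSpec n (MvPolynomial.esymm (Fin (2 * n)) K (2 * n - 1)))
      ⟨planesInCoordinateSubspace K n i j, hc⟩ ≅ grassmannian K n (2 * n - 2)) := by
  obtain ⟨g, hg, hK, hmem, -⟩ := exists_gradedRingHom_planesInCoordinateSubspace (K := K) hij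
  have := isClosedImmersion_projMap g hg
  have : AlgebraicGeometry.IsReduced
      (Proj (pluckerGrading K (Matrix.mvPolynomialX (Fin (2 * n - 2)) (Fin n) K))) := isReduced_proj
  have hrange : Set.range (Proj.map g (irrelevant_le_map_of_surjective g hg)) =
      planesInCoordinateSubspace K n i j := by
    ext x
    exact (mem_range_projMap_iff g hg x).trans (hmem x).symm
  have h := nonempty_reducedClosed_iso
    (fanoSchemeToSpec n (MvPolynomial.esymm (Fin (2 * n)) K (2 * n - 1)))
    (Proj.map g (irrelevant_le_map_of_surjective g hg)) ⟨_, hc⟩ hrange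
  have hcomp : Proj.map g (irrelevant_le_map_of_surjective g hg) ≫
      fanoSchemeToSpec n (MvPolynomial.esymm (Fin (2 * n)) K (2 * n - 1)) =
      pluckerProjToSpec K (Matrix.mvPolynomialX (Fin (2 * n - 2)) (Fin n) K) :=
    projMap_toSpecZero g _ hK
  rw [hcomp] at h
  exact h

lemma ncard_planes (hn : 2 ≤ n) : {Z : Set (esymmFano K n) | ∃ i j : Fin (2 * n), i < j ∧
    Z = planesInCoordinateSubspace K n i j}.ncard = Nat.choose (2 * n) 2 := by
  have h1 : (Finset.powersetCard 2 (Finset.univ : Finset (Fin (2 * n)))).card =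
      Nat.choose (2 * n) 2 := by
    rw [Finset.card_powersetCard, Finset.card_univ, Fintype.card_fin]
  have h2 : (Finset.univ.filter fun q : Fin (2 * n) × Fin (2 * n) => q.1 < q.2).card =
      Nat.choose (2 * n) 2 := by
    rw [← h1]
    refine Finset.card_bij (fun q _ => {q.1, q.2}) ?_ ?_ ?_
    · intro q hq
      rw [Finset.mem_powersetCard]
      exact ⟨Finset.subset_univ _, Finset.card_pair (Finset.mem_filter.mp hq).2.ne⟩
    · rintro ⟨a, b⟩ hq ⟨c, d⟩ hq' h
      replace hq : a < b := (Finset.mem_filter.mp hq).2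
      replace hq' : c < d := (Finset.mem_filter.mp hq').2
      have ha : a ∈ ({c, d} : Finset (Fin (2 * n))) := h ▸ Finset.mem_insert_self a {b}
      have hb : b ∈ ({c, d} : Finset (Fin (2 * n))) :=
        h ▸ Finset.mem_insert_of_mem (Finset.mem_singleton_self b)
      simp only [Finset.mem_insert, Finset.mem_singleton] at ha hb
      rw [Prod.mk.injEq]
      lia
    · intro t ht
      obtain ⟨a, b, hab, rfl⟩ := Finset.card_eq_two.mp (Finset.mem_powersetCard.mp ht).2
      rcases lt_or_gt_of_ne hab with h | h
      · exact ⟨(a, b), by simp [h], rfl⟩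
      · exact ⟨(b, a), by simp [h], Finset.pair_comm _ _⟩
  rw [← h2, ← Set.ncard_coe_finset]
  symm
  refine Set.ncard_congr (fun q _ => planesInCoordinateSubspace K n q.1 q.2) ?_ ?_ ?_
  · intro q hq
    exact ⟨q.1, q.2, by simpa using hq, rfl⟩
  · rintro ⟨a, b⟩ ⟨c, d⟩ hq hq' h
    obtain ⟨rfl, rfl⟩ := planes_subset_iff hn (by simpa using hq) (by simpa using hq') h.subset
    rfl
  · rintro Z ⟨i, j, hij, rfl⟩
    exact ⟨(i, j), by simpa using hij, rfl⟩

end Main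

end FanoPlanes

end

theorem mainTheorem5 (K : Type u) [Field K] (n : ℕ) (hn : 2 ≤ n) :
    -- the isolated closed points given by the perfect matchings
    ((∀ M : (⊤ : SimpleGraph (Fin (2 * n))).Subgraph, M.IsPerfectMatching →
        ∃! x : FanoPlanes.esymmFano K n,
          FanoPlanes.IsPointOf x (FanoPlanes.matchingSpace K M)) ∧
      (∀ M : (⊤ : SimpleGraph (Fin (2 * n))).Subgraph, M.IsPerfectMatching →
        ∀ x : FanoPlanes.esymmFano K n,
          FanoPlanes.IsPointOf x (FanoPlanes.matchingSpace K M) →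
            IsClosed {x} ∧ IsOpen {x}) ∧
      {x : FanoPlanes.esymmFano K n |
        ∃ M : (⊤ : SimpleGraph (Fin (2 * n))).Subgraph, M.IsPerfectMatching ∧
          FanoPlanes.IsPointOf x (FanoPlanes.matchingSpace K M)}.ncard =
        Nat.doubleFactorial (2 * n - 1) ∧
      Nat.doubleFactorial (2 * n - 1) * (2 ^ n * Nat.factorial n) = Nat.factorial (2 * n)) ∧
    -- the irreducible components given by pairs of coordinates
    ((∀ i j : Fin (2 * n), i < j →
        ∃ h : FanoPlanes.planesInCoordinateSubspace K n i j ∈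
            irreducibleComponents (FanoPlanes.esymmFano K n),
          Nonempty
            (FanoPlanes.reducedClosed
                (FanoPlanes.fanoSchemeToSpec n
                  (MvPolynomial.esymm (Fin (2 * n)) K (2 * n - 1)))
                ⟨FanoPlanes.planesInCoordinateSubspace K n i j,
                  isClosed_of_mem_irreducibleComponents _ h⟩ ≅
              FanoPlanes.grassmannian K n (2 * n - 2))) ∧
      {Z : Set (FanoPlanes.esymmFano K n) |
        ∃ i j : Fin (2 * n), i < j ∧
          Z = FanoPlanes.planesInCoordinateSubspace K n i j}.ncard = Nat.choose (2 * n) 2) := by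
  have hn0 : n ≠ 0 := by lia
  refine ⟨⟨fun M hM => FanoPlanes.existsUnique_isPointOf_matchingSpace hn0 hM,
    fun M hM x hx => ⟨FanoPlanes.isClosed_of_isPointOf hx,
      FanoPlanes.isOpen_of_mem_matchingPoints hn ⟨M, hM, hx⟩⟩,
    FanoPlanes.ncard_matchingPoints hn0,
    FanoPlanes.doubleFactorial_mul_two_pow_mul_factorial hn0⟩,
    fun i j hij => ⟨FanoPlanes.planes_mem_irreducibleComponents hn hij,
      FanoPlanes.nonempty_reducedClosed_planes_iso hij.ne _⟩,
    FanoPlanes.ncard_planes hn⟩
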